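/- **Setting.** A simplicial complex $X$ is a set with a family of finite subsets (linked parts) containing $\emptyset$ and all singletons and closed under subsets; a map preserves linked parts. The line $\mathbf Z$ has as linked parts the subsets of the pairs $\{i,i+1\}$. In $\mathrm{Hom}(Y,X)$, the set of maps $Y\to X$, a finite set $F$ of maps is linked when $\bigcup_{f\in F} f(\xi)$ is linked in $X$ for every linked $\xi\subset Y$. The path object $PX\subset \mathrm{Hom}(\mathbf Z,X)$ is the subspace (with the induced structure) of those maps $a:\mathbf Z\to X$ that are constant on $]-\infty,\rho^-]$ and on $[\rho^+,\infty[$ for some integers $\rho^-\le\rho^+$; the two values are its faces $\partial^\pm a$. For $X$ pointed at $*$, $\Omega X\subset PX$ is the subspace of loops $a$ with $\partial^-a=*=\partial^+a$, pointed at the constant loop. $\pi_0(X)$ is the quotient of $X$ by the equivalence relation generated by "$\{x,x'\}$ is linked", and $\pi_n(X)=\pi_0(\Omega^nX)$. So an element of $\pi_n(X)$ is the class of a net $a:\mathbf Z^n\to X$ equal to $*$ at all $i$ with some $i_r\le p$ or some $i_r\ge q$, for suitable integers $p\le q$ ($[p,q]^n$ is then called a support of $a$). For $n\ge1$, $\pi_n(X)$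 is a group under $[a]\cdot[b]=[c]$, where $c$ is any concatenation of $a$ and $b$ (first $a$, then $b$) regarded as loops in $\Omega^{n-1}X$. The geometric realisation $\mathfrak SX$ is the set of functions $\lambda:X\to[0,1]$ with linked support and $\sum_x\lambda(x)=1$, with the direct limit (weak) topology determined by the closed simplices $\{\lambda : \mathrm{supp}\,\lambda\subset\xi\}$ ($\xi$ linked and non-empty) with their euclidean topology; it is pointed at the vertex $*$. The multi-affine extension $\hat a:\mathbf R^n\to\mathfrak SX$ of a net $a$ is the continuous map extending $a$ which is affine in each variable on each elementary cube $\prod_r[i_r,i_r+1]$, $i\in\mathbf Z^n$. If $[p,q]^n$ is a support of $a$, then $t\mapsto \hat a\big(p+(q-p)t_1,\dots,p+(q-p)t_n\big)$ is a map $[0,1]^n\to\mathfrak SX$ sending the boundary to $*$; its class in the topological homotopy group $\pi_n(\mathfrak SX,*)$ is denoted $[\hat a]$. **Theorem (simplicial comparison).** There is a family of mappings $\Phi_n=\Phi_{n,X}:\pi_n(X)\to\pi_n(\mathfrak SX,*)$, for all $n\ge0$ and all pointed simplicial complexes $X$, such that: 1. $\Phi_n[a]=[\hat a]$ for every net $a$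 representing an element of $\pi_n(X)$ and every support $[p,q]^n$ of $a$; 2. each $\Phi_n$ is bijective and preserves the base point (the class of the constant net); 3. for $n\ge1$, $\Phi_n$ is a group homomorphism (hence a group isomorphism), the product of the topological classes $[f],[g]$ being the class of the concatenation "first $f$, then $g$" along any one of the $n$ coordinates; 4. $\Phi_n$ is natural: for every pointed map $f:X\to Y$, $\Phi_{n,Y}\circ\pi_n(f)=\pi_n(\mathfrak Sf)\circ\Phi_{n,X}$. -/

import Mathlib

open Topology
open scoped Topology.Homotopy

universe u v

noncomputable section

/-! ### Simplicial complexes, linked parts and maps -/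

/-- A simplicial complex (combinatorial space): a set with an abstract simplicial complex on it
in which every singleton is a face. -/
structure CSpace : Type (u + 1) where
  /-- the underlying set -/
  carrier : Type u
  /-- the complex of nonempty linked parts -/
  cx : AbstractSimplicialComplex carrier

namespace CSpace

instance : CoeSort CSpace.{u} (Type u) := ⟨CSpace.carrier⟩

/-- The linked parts: the empty set and the faces of the complex. -/
def Linked (X : CSpace.{u}) (s : Set X) : Prop :=
  s = ∅ ∨ ∃ t ∈ X.cx, (t : Set X) = s

theorem Linked.finite {X : CSpace.{u}} {s : Set X} (h : X.Linked s) : s.Finite := by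
  rcases h with rfl | ⟨t, -, rfl⟩
  · exact Set.finite_empty
  · exact t.finite_toSet

theorem Linked.mono {X : CSpace.{u}} {s t : Set X} (h : X.Linked s) (hts : t ⊆ s) :
    X.Linked t := by
  rcases t.eq_empty_or_nonempty with ht | ht
  · exact Or.inl ht
  · rcases h with rfl | ⟨k, hk, rfl⟩
    · exact Or.inl (Set.subset_empty_iff.1 hts)
    · have hf : t.Finite := k.finite_toSet.subset hts
      refine Or.inr ⟨hf.toFinset, ?_, by simp⟩
      exact (X.cx.isRelLowerSet_faces hk).2 (by simpa [← Finset.coe_subset] using hts)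
        (by simpa using ht)

theorem linked_empty (X : CSpace.{u}) : X.Linked ∅ := Or.inl rfl

theorem linked_singleton (X : CSpace.{u}) (x : X) : X.Linked {x} :=
  Or.inr ⟨{x}, X.cx.singleton_mem x, by simp⟩

theorem Linked.mem {X : CSpace.{u}} {t : Finset X} (h : X.Linked (t : Set X))
    (ht : t.Nonempty) : t ∈ X.cx := by
  rcases h with h | ⟨k, hk, h⟩
  · exact absurd h (by simpa using ht.ne_empty)
  · rwa [← Finset.coe_injective h]

/-- The simplicial complex whose linked parts are the finite sets satisfying `L`. -/
abbrev ofLinked (α : Type u) (L : Set α → Prop) (h1 : ∀ x, L {x})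
    (hd : ∀ s t, L s → t ⊆ s → L t) : CSpace.{u} where
  carrier := α
  cx :=
    { faces := {t | t.Nonempty ∧ L t}
      isRelLowerSet_faces := fun _ ht =>
        ⟨ht.1, fun _ hb hne => ⟨hne, hd _ _ ht.2 (Finset.coe_subset.2 hb)⟩⟩
      singleton_mem := fun x => ⟨Finset.singleton_nonempty x, by simpa using h1 x⟩ }

theorem linked_ofLinked {α : Type u} {L : Set α → Prop} {h1 : ∀ x, L {x}}
    {hd : ∀ s t, L s → t ⊆ s → L t} (h0 : L ∅) {s : Set α} :
    (ofLinked α L h1 hd).Linked s ↔ s.Finite ∧ L s := by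
  constructor
  · intro h
    refine ⟨h.finite, ?_⟩
    rcases h with rfl | ⟨t, ht, rfl⟩
    · exact h0
    · exact ht.2
  · rintro ⟨hf, hL⟩
    rcases s.eq_empty_or_nonempty with hs | hs
    · exact Or.inl hs
    · refine Or.inr ⟨hf.toFinset, ⟨by simpa using hs, ?_⟩, by simp⟩
      simpa using hL

/-- A mapping is a combinatorial map when it preserves the linked parts. -/
def IsMap (X : CSpace.{u}) (Y : CSpace.{v}) (f : X → Y) : Prop :=
  ∀ s : Set X, X.Linked s → Y.Linked (f '' s)

/-- The internal hom: a finite set `F` of maps is linked when `⋃ f ∈ F, f '' s` is linked for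
all linked `s`. -/
abbrev Hom (X : CSpace.{u}) (Y : CSpace.{v}) : CSpace.{max u v} :=
  ofLinked {f : X → Y // IsMap X Y f}
    (fun F => ∀ s : Set X, X.Linked s → Y.Linked (⋃ f ∈ F, f.1 '' s))
    (fun f s hs => by simpa using f.2 s hs)
    (fun _ _ h hts s hs => (h s hs).mono (Set.biUnion_subset_biUnion_left hts))

/-- The combinatorial subspace on a subset: a part is linked iff it is so in the ambient space. -/
abbrev sub (Y : CSpace.{u}) (S : Set Y) : CSpace.{u} :=
  ofLinked S (fun t => Y.Linked (Subtype.val '' t))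
    (fun x => by simpa using Y.linked_singleton x.1)
    (fun _ _ h hts => h.mono (Set.image_mono hts))

theorem linked_hom {X : CSpace.{u}} {Y : CSpace.{v}} {F : Set (Hom X Y)} :
    (Hom X Y).Linked F ↔ F.Finite ∧ ∀ s : Set X, X.Linked s → Y.Linked (⋃ f ∈ F, f.1 '' s) :=
  linked_ofLinked fun s _ => by simpa using Y.linked_empty

theorem linked_sub {Y : CSpace.{u}} {S : Set Y} {t : Set (Y.sub S)} :
    (Y.sub S).Linked t ↔ t.Finite ∧ Y.Linked (Subtype.val '' t) :=
  linked_ofLinked (by simpa using Y.linked_empty)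

/-- The standard integral line: the structure generated by the contiguous pairs `{i, i + 1}`. -/
abbrev line : CSpace.{0} :=
  ofLinked ℤ (fun s => ∃ i : ℤ, s ⊆ {i, i + 1})
    (fun i => ⟨i, by simp⟩) (fun _ _ ⟨i, hi⟩ hts => ⟨i, hts.trans hi⟩)

/-! ### The path functor -/

/-- `[p, q]` is an admissible support of the line `a`. -/
def IsLineSupport {X : Type u} (a : ℤ → X) (p q : ℤ) : Prop :=
  p ≤ q ∧ (∀ i ≤ p, a i = a p) ∧ (∀ i, q ≤ i → a i = a q)

/-- The path object: the subspace of `Hom line X` of the lines having a support. -/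
abbrev Path (X : CSpace.{u}) : CSpace.{u} :=
  (Hom line X).sub {a | ∃ p q : ℤ, IsLineSupport a.1 p q}

/-- The lower face of a path. -/
def Path.lower {X : CSpace.{u}} (a : Path X) : X := a.1.1 a.2.choose

/-- The upper face of a path. -/
def Path.upper {X : CSpace.{u}} (a : Path X) : X := a.1.1 a.2.choose_spec.choose

theorem Path.lower_eq {X : CSpace.{u}} (a : Path X) {p : ℤ} {x : X}
    (h : ∀ i ≤ p, a.1.1 i = x) : Path.lower a = x := by
  obtain ⟨-, h1, -⟩ := a.2.choose_spec.choose_spec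
  rw [← h (min p a.2.choose) (min_le_left _ _)]
  exact (h1 _ (min_le_right _ _)).symm

theorem Path.upper_eq {X : CSpace.{u}} (a : Path X) {q : ℤ} {x : X}
    (h : ∀ i, q ≤ i → a.1.1 i = x) : Path.upper a = x := by
  obtain ⟨-, -, h2⟩ := a.2.choose_spec.choose_spec
  rw [← h (max q a.2.choose_spec.choose) (le_max_left _ _)]
  exact (h2 _ (le_max_right _ _)).symm

/-- Path components: the quotient by the equivalence relation generated by `x ! y`. -/
def pi0 (X : CSpace.{u}) : Type u := Quot fun x y : X => X.Linked {x, y}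

end CSpace

/-! ### Pointed complexes, loops and homotopy groups -/

/-- A pointed simplicial complex. -/
structure PCSpace : Type (u + 1) extends CSpace.{u} where
  /-- the base point -/
  pt : carrier

/-- A map of pointed simplicial complexes. -/
structure PMap (X Y : PCSpace.{u}) : Type u where
  /-- the underlying mapping -/
  toFun : X.carrier → Y.carrier
  isMap : CSpace.IsMap X.toCSpace Y.toCSpace toFun
  map_pt : toFun X.pt = Y.pt

namespace PCSpace

/-- The constant path at the base point. -/
def constPath (X : PCSpace.{u}) : CSpace.Path X.toCSpace :=
  ⟨⟨fun _ => X.pt, fun _ _ => (X.linked_singleton X.pt).mono (by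
    rintro _ ⟨_, -, rfl⟩; rfl)⟩, 0, 0, le_rfl, fun _ _ => rfl, fun _ _ => rfl⟩

/-- The loop object: the subspace of the path object of the paths with both faces at the base
point, pointed at the constant loop. -/
abbrev Omega (X : PCSpace.{u}) : PCSpace.{u} where
  toCSpace := (CSpace.Path X.toCSpace).sub {a | CSpace.Path.lower a = X.pt ∧ CSpace.Path.upper a = X.pt}
  pt := ⟨constPath X, rfl, rfl⟩

/-- The sequence of points of a loop. -/
def Omega.val {X : PCSpace.{u}} (a : (Omega X).carrier) : ℤ → X.carrier := a.1.1.1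

theorem Omega.ext {X : PCSpace.{u}} {a b : (Omega X).carrier}
    (h : ∀ i, Omega.val a i = Omega.val b i) : a = b :=
  Subtype.ext (Subtype.ext (Subtype.ext (funext h)))

theorem Omega.isMap {X : PCSpace.{u}} (a : (Omega X).carrier) :
    CSpace.IsMap CSpace.line X.toCSpace (Omega.val a) := a.1.1.2

theorem Omega.exists_support {X : PCSpace.{u}} (a : (Omega X).carrier) :
    ∃ p q : ℤ, p ≤ q ∧ (∀ i ≤ p, Omega.val a i = X.pt) ∧ ∀ i, q ≤ i → Omega.val a i = X.pt := by
  obtain ⟨p, q, hpq, hp, hq⟩ := a.1.2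
  refine ⟨p, q, hpq, fun i hi => ?_, fun i hi => ?_⟩
  · rw [← a.2.1, CSpace.Path.lower_eq a.1 hp]; exact hp i hi
  · rw [← a.2.2, CSpace.Path.upper_eq a.1 hq]; exact hq i hi

theorem line_linked {s : Set ℤ} :
    CSpace.line.Linked s ↔ ∃ i : ℤ, s ⊆ {i, i + 1} := by
  refine (CSpace.linked_ofLinked ⟨0, by simp⟩).trans ⟨fun h => h.2, fun h => ⟨?_, h⟩⟩
  obtain ⟨i, hi⟩ := h
  exact (Set.toFinite _).subset hi

/-- A loop is determined by a sequence with linked consecutive terms which is eventually at the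
base point on both sides. -/
def Omega.mk {X : PCSpace.{u}} (f : ℤ → X.carrier) (hf : ∀ i, X.Linked {f i, f (i + 1)})
    (h : ∃ p q : ℤ, (∀ i ≤ p, f i = X.pt) ∧ ∀ i, q ≤ i → f i = X.pt) : (Omega X).carrier :=
  ⟨⟨⟨f, fun s hs => by
      obtain ⟨i, hi⟩ := line_linked.1 hs
      exact (hf i).mono ((Set.image_mono hi).trans (by rw [Set.image_pair]))⟩, by
      obtain ⟨p, q, hp, hq⟩ := h
      refine ⟨min p q, max p q, min_le_max, fun i hi => ?_, fun i hi => ?_⟩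
      · exact (hp i (by omega)).trans (hp _ (min_le_left _ _)).symm
      · exact (hq i (by omega)).trans (hq _ (le_max_right _ _)).symm⟩, by
    obtain ⟨p, q, hp, hq⟩ := h
    exact ⟨CSpace.Path.lower_eq _ hp, CSpace.Path.upper_eq _ hq⟩⟩

@[simp] theorem Omega.val_mk {X : PCSpace.{u}} (f : ℤ → X.carrier)
    (hf : ∀ i, X.Linked {f i, f (i + 1)})
    (h : ∃ p q : ℤ, (∀ i ≤ p, f i = X.pt) ∧ ∀ i, q ≤ i → f i = X.pt) (i : ℤ) :
    Omega.val (Omega.mk f hf h) i = f i := rfl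

@[simp] theorem Omega.val_pt {X : PCSpace.{u}} (i : ℤ) : Omega.val (Omega X).pt i = X.pt := rfl

theorem Omega.linked_iff {X : PCSpace.{u}} {s : Set (Omega X).carrier} :
    (Omega X).Linked s ↔
      s.Finite ∧ ∀ i : ℤ, X.Linked (⋃ a ∈ s, {Omega.val a i, Omega.val a (i + 1)}) := by
  have key : ∀ (F : Set (Omega X).carrier) (t : Set ℤ),
      (⋃ f ∈ Subtype.val '' (Subtype.val '' F), f.1 '' t : Set X.carrier)
        = ⋃ a ∈ F, Omega.val a '' t := by
    intro F t
    simp only [Set.biUnion_image]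
    rfl
  have e1 : (Omega X).Linked s ↔ s.Finite ∧ (CSpace.Path X.toCSpace).Linked (Subtype.val '' s) :=
    CSpace.linked_sub
  have e2 : ∀ t : Set (CSpace.Path X.toCSpace), (CSpace.Path X.toCSpace).Linked t ↔
      t.Finite ∧ (CSpace.Hom CSpace.line X.toCSpace).Linked (Subtype.val '' t) := fun t =>
    CSpace.linked_sub
  have e3 : ∀ t : Set (CSpace.Hom CSpace.line X.toCSpace),
      (CSpace.Hom CSpace.line X.toCSpace).Linked t ↔
      t.Finite ∧ ∀ r : Set ℤ, CSpace.line.Linked r → X.Linked (⋃ f ∈ t, f.1 '' r) := fun t =>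
    CSpace.linked_hom
  rw [e1, e2, e3]
  constructor
  · rintro ⟨hf, -, -, h⟩
    refine ⟨hf, fun i => ?_⟩
    have := h {i, i + 1} (line_linked.2 ⟨i, le_rfl⟩)
    rw [key] at this
    simpa only [Set.image_pair] using this
  · rintro ⟨hf, h⟩
    refine ⟨hf, hf.image _, (hf.image _).image _, fun r hr => ?_⟩
    obtain ⟨i, hi⟩ := line_linked.1 hr
    rw [key]
    refine (h i).mono (Set.iUnion₂_mono fun a _ => ?_)
    exact (Set.image_mono hi).trans (by rw [Set.image_pair])

theorem Omega.linked_pair {X : PCSpace.{u}} {a b : (Omega X).carrier}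
    (h : ∀ i, X.Linked ({Omega.val a i, Omega.val a (i + 1)} ∪
      {Omega.val b i, Omega.val b (i + 1)})) :
    (Omega X).Linked {a, b} :=
  Omega.linked_iff.2 ⟨Set.toFinite _, fun i => by simpa only [Set.biUnion_pair] using h i⟩

theorem Omega.linked_val {X : PCSpace.{u}} (a : (Omega X).carrier) (i : ℤ) :
    X.Linked {Omega.val a i, Omega.val a (i + 1)} := by
  have := Omega.isMap a {i, i + 1} (line_linked.2 ⟨i, le_rfl⟩)
  rwa [Set.image_pair] at this

/-- `c` is an admissible concatenation of the loops `a` and `b`: for some upper bound `p` of a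
support of `a` and lower bound `q` of a support of `b`, with pasting point `p + q`. -/
def Omega.IsConcat {X : PCSpace.{u}} (a b c : (Omega X).carrier) : Prop :=
  ∃ p q : ℤ, (∀ i, p ≤ i → Omega.val a i = X.pt) ∧ (∀ i ≤ q, Omega.val b i = X.pt) ∧
    (∀ i ≤ p + q, Omega.val c i = Omega.val a (i - q)) ∧
    ∀ i, p + q ≤ i → Omega.val c i = Omega.val b (i - p)

/-- The admissible concatenation determined by `p` and `q`. -/
def Omega.concat {X : PCSpace.{u}} (a b : (Omega X).carrier) (p q : ℤ)
    (ha : ∀ i, p ≤ i → Omega.val a i = X.pt) (hb : ∀ i ≤ q, Omega.val b i = X.pt) :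
    (Omega X).carrier :=
  Omega.mk (fun i => if i ≤ p + q then Omega.val a (i - q) else Omega.val b (i - p))
    (fun i => by
      by_cases h : i + 1 ≤ p + q
      · have h' : i ≤ p + q := by omega
        simp only [h, h', if_true]
        have := Omega.linked_val a (i - q)
        rwa [show i - q + 1 = i + 1 - q by ring] at this
      · have := Omega.linked_val b (i - p)
        rw [show i - p + 1 = i + 1 - p by ring] at this
        by_cases h' : i ≤ p + q
        · simp only [h, h', if_true, if_false]
          rwa [ha (i - q) (by omega), ← hb (i - p) (by omega)]
        · simpa only [h, h', if_false] using this)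
    (by
      obtain ⟨p1, -, -, h1, -⟩ := Omega.exists_support a
      obtain ⟨-, q2, -, -, h2⟩ := Omega.exists_support b
      refine ⟨min (p + q) (p1 + q), max (p + q + 1) (q2 + p), fun i hi => ?_, fun i hi => ?_⟩
      · rw [if_pos (by omega)]; exact h1 _ (by omega)
      · rw [if_neg (by omega)]; exact h2 _ (by omega))

/-- The class of a loop. -/
abbrev Omega.cls {X : PCSpace.{u}} (a : (Omega X).carrier) : (Omega X).pi0 := Quot.mk _ a

theorem Omega.IsConcat.eq_concat {X : PCSpace.{u}} {a b c : (Omega X).carrier}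
    (h : Omega.IsConcat a b c) : ∃ p q ha hb, c = Omega.concat a b p q ha hb := by
  obtain ⟨p, q, ha, hb, h1, h2⟩ := h
  refine ⟨p, q, ha, hb, Omega.ext fun i => ?_⟩
  by_cases hi : i ≤ p + q
  · simp [Omega.concat, hi, h1 i hi]
  · simp [Omega.concat, hi, h2 i (by omega)]

theorem Omega.isConcat_concat {X : PCSpace.{u}} (a b : (Omega X).carrier) (p q : ℤ)
    (ha : ∀ i, p ≤ i → Omega.val a i = X.pt) (hb : ∀ i ≤ q, Omega.val b i = X.pt) :
    Omega.IsConcat a b (Omega.concat a b p q ha hb) := by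
  refine ⟨p, q, ha, hb, fun i hi => by simp [Omega.concat, hi], fun i hi => ?_⟩
  by_cases h : i ≤ p + q
  · simp [Omega.concat, h, ha (i - q) (by omega), hb (i - p) (by omega)]
  · simp [Omega.concat, h]

/-- The loop delayed of one unit at the instant `t`. -/
def Omega.delay {X : PCSpace.{u}} (a : (Omega X).carrier) (t : ℤ) : (Omega X).carrier :=
  Omega.mk (fun i => Omega.val a (if i ≤ t then i else i - 1))
    (fun i => by
      by_cases h : i + 1 ≤ t
      · have h' : i ≤ t := by omega
        simpa only [h, h', if_true] using Omega.linked_val a i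
      · by_cases h' : i ≤ t
        · simpa only [h, h', if_true, if_false, add_sub_cancel_right, Set.pair_eq_singleton]
            using X.linked_singleton _
        · have := Omega.linked_val a (i - 1)
          rw [show i - 1 + 1 = i + 1 - 1 by ring] at this
          simpa only [h, h', if_false] using this)
    (by
      obtain ⟨p, q, -, h1, h2⟩ := Omega.exists_support a
      refine ⟨p, q + 1, fun i hi => h1 _ ?_, fun i hi => h2 _ ?_⟩ <;> split_ifs <;> omega)

theorem Omega.cls_delay_succ {X : PCSpace.{u}} (a : (Omega X).carrier) (t : ℤ) :
    Omega.cls (Omega.delay a t) = Omega.cls (Omega.delay a (t + 1)) := by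
  refine Quot.sound (Omega.linked_pair fun i => ?_)
  by_cases hi : i ≤ t
  · refine (Omega.linked_val a i).mono ?_
    rintro x ((rfl | rfl) | (rfl | rfl)) <;> simp only [Omega.delay, Omega.val_mk] <;>
      grind
  · refine (Omega.linked_val a (i - 1)).mono ?_
    rintro x ((rfl | rfl) | (rfl | rfl)) <;> simp only [Omega.delay, Omega.val_mk] <;>
      grind

theorem Omega.cls_delay {X : PCSpace.{u}} (a : (Omega X).carrier) (t : ℤ) :
    Omega.cls (Omega.delay a t) = Omega.cls a := by
  have h : ∀ k : ℕ, Omega.cls (Omega.delay a t) = Omega.cls (Omega.delay a (t + k)) := by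
    intro k
    induction k with
    | zero => simp
    | succ k ih =>
      rw [ih, Omega.cls_delay_succ]
      congr 2
      push_cast
      ring
  obtain ⟨p, q, -, h1, h2⟩ := Omega.exists_support a
  rw [h (q - t).toNat]
  congr 1
  refine Omega.ext fun i => ?_
  simp only [Omega.delay, Omega.val_mk]
  split_ifs with hi
  · rfl
  · rw [h2 _ (by omega), h2 _ (by omega)]

theorem Omega.concat_succ {X : PCSpace.{u}} (a b : (Omega X).carrier) (p q : ℤ)
    (ha : ∀ i, p ≤ i → Omega.val a i = X.pt) (hb : ∀ i ≤ q, Omega.val b i = X.pt) :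
    Omega.cls (Omega.concat a b (p + 1) q (fun i hi => ha i (by omega)) hb) =
      Omega.cls (Omega.concat a b p q ha hb) := by
  rw [← Omega.cls_delay (Omega.concat a b p q ha hb) (p + q)]
  congr 1
  refine Omega.ext fun i => ?_
  simp only [Omega.delay, Omega.concat, Omega.val_mk]
  rcases lt_trichotomy i (p + q + 1) with h | h | h
  · rw [if_pos (by omega), if_pos (by omega), if_pos (by omega)]
  · rw [if_pos (show i ≤ p + 1 + q by omega), if_neg (show ¬ i ≤ p + q by omega),
      if_pos (show i - 1 ≤ p + q by omega)]
    exact (ha _ (by omega)).trans (ha _ (by omega)).symm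
  · rw [if_neg (by omega), if_neg (by omega), if_neg (by omega)]
    congr 1
    ring

theorem Omega.concat_pred {X : PCSpace.{u}} (a b : (Omega X).carrier) (p q : ℤ)
    (ha : ∀ i, p ≤ i → Omega.val a i = X.pt) (hb : ∀ i ≤ q, Omega.val b i = X.pt) :
    Omega.cls (Omega.concat a b p (q - 1) ha (fun i hi => hb i (by omega))) =
      Omega.cls (Omega.concat a b p q ha hb) := by
  rw [← Omega.concat_succ a b p q ha hb]
  obtain ⟨p1, -, -, h1, -⟩ :=
    Omega.exists_support (Omega.concat a b p (q - 1) ha (fun i hi => hb i (by omega)))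
  rw [← Omega.cls_delay (Omega.concat a b p (q - 1) ha (fun i hi => hb i (by omega)))
    (p1 - 1)]
  congr 1
  refine Omega.ext fun i => ?_
  have e : Omega.val (Omega.delay
      (Omega.concat a b p (q - 1) ha (fun i hi => hb i (by omega))) (p1 - 1)) i =
      Omega.val (Omega.concat a b p (q - 1) ha (fun i hi => hb i (by omega))) (i - 1) := by
    simp only [Omega.delay, Omega.val_mk]
    split_ifs with hi
    · rw [h1 _ (by omega), h1 _ (by omega)]
    · rfl
  rw [e]
  simp only [Omega.concat, Omega.val_mk]
  rcases lt_trichotomy i (p + q + 1) with h | h | h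
  · rw [if_pos (by omega), if_pos (by omega)]
    congr 1
    ring
  · rw [if_neg (by omega), if_pos (by omega), ha _ (by omega), hb _ (by omega)]
  · rw [if_neg (by omega), if_neg (by omega)]
    congr 1
    ring

theorem Omega.concat_add {X : PCSpace.{u}} (a b : (Omega X).carrier) (p q : ℤ)
    (ha : ∀ i, p ≤ i → Omega.val a i = X.pt) (hb : ∀ i ≤ q, Omega.val b i = X.pt)
    (p1 q1 : ℤ) (hp : p ≤ p1) (hq : q1 ≤ q) :
    Omega.cls (Omega.concat a b p1 q1 (fun i hi => ha i (by omega))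
      (fun i hi => hb i (by omega))) = Omega.cls (Omega.concat a b p q ha hb) := by
  have h1 : ∀ p1, p ≤ p1 → ∀ ha1 : (∀ i, p1 ≤ i → Omega.val a i = X.pt),
      Omega.cls (Omega.concat a b p1 q ha1 hb) = Omega.cls (Omega.concat a b p q ha hb) := by
    refine Int.leInduction (fun _ => rfl) fun n hn ih ha1 => ?_
    rw [← ih fun i hi => ha i (by omega)]
    exact Omega.concat_succ a b n q _ hb
  have h2 : ∀ q1, q1 ≤ q → ∀ hb1 : (∀ i ≤ q1, Omega.val b i = X.pt),
      Omega.cls (Omega.concat a b p1 q1 (fun i hi => ha i (by omega)) hb1) =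
        Omega.cls (Omega.concat a b p q ha hb) := by
    refine Int.leInductionDown (fun _ => h1 p1 hp _) fun n hn ih hb1 => ?_
    rw [← ih fun i hi => hb i (by omega)]
    exact Omega.concat_pred a b p1 n _ _
  exact h2 q1 hq _

/-- All admissible concatenations of two loops are in the same class. -/
theorem Omega.cls_concat_eq {X : PCSpace.{u}} {a b c d : (Omega X).carrier}
    (hc : Omega.IsConcat a b c) (hd : Omega.IsConcat a b d) : Omega.cls c = Omega.cls d := by
  obtain ⟨p, q, ha, hb, rfl⟩ := hc.eq_concat
  obtain ⟨p1, q1, ha1, hb1, rfl⟩ := hd.eq_concat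
  rw [← Omega.concat_add a b p q ha hb (max p p1) (min q q1) (le_max_left _ _) (min_le_left _ _),
    ← Omega.concat_add a b p1 q1 ha1 hb1 (max p p1) (min q q1) (le_max_right _ _)
      (min_le_right _ _)]

theorem Omega.exists_isConcat {X : PCSpace.{u}} (a b : (Omega X).carrier) :
    ∃ c, Omega.IsConcat a b c := by
  obtain ⟨-, q, -, -, h2⟩ := Omega.exists_support a
  obtain ⟨p, -, -, h1, -⟩ := Omega.exists_support b
  exact ⟨_, Omega.isConcat_concat a b q p h2 h1⟩

/-- A concatenation of two loops. -/
def Omega.add {X : PCSpace.{u}} (a b : (Omega X).carrier) : (Omega X).carrier :=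
  (Omega.exists_isConcat a b).choose

theorem Omega.add_spec {X : PCSpace.{u}} (a b : (Omega X).carrier) :
    Omega.IsConcat a b (Omega.add a b) := (Omega.exists_isConcat a b).choose_spec

theorem Omega.cls_add {X : PCSpace.{u}} {a b c : (Omega X).carrier}
    (h : Omega.IsConcat a b c) : Omega.cls (Omega.add a b) = Omega.cls c :=
  Omega.cls_concat_eq (Omega.add_spec a b) h

theorem Omega.pair_linked_iff {X : PCSpace.{u}} {a b : (Omega X).carrier} :
    (Omega X).Linked {a, b} ↔ ∀ i, X.Linked ({Omega.val a i, Omega.val a (i + 1)} ∪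
      {Omega.val b i, Omega.val b (i + 1)}) :=
  ⟨fun h i => by simpa only [Set.biUnion_pair] using (Omega.linked_iff.1 h).2 i,
    Omega.linked_pair⟩

theorem Omega.cls_add_congr {X : PCSpace.{u}} {a b a1 b1 : (Omega X).carrier}
    (ha : (Omega X).Linked {a, a1}) (hb : (Omega X).Linked {b, b1}) :
    Omega.cls (Omega.add a b) = Omega.cls (Omega.add a1 b1) := by
  obtain ⟨-, s, -, -, h1⟩ := Omega.exists_support a
  obtain ⟨-, s1, -, -, h2⟩ := Omega.exists_support a1
  obtain ⟨r, -, -, h3, -⟩ := Omega.exists_support b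
  obtain ⟨r1, -, -, h4, -⟩ := Omega.exists_support b1
  have c1 := Omega.isConcat_concat a b (max s s1) (min r r1) (fun i hi => h1 i (by omega))
    (fun i hi => h3 i (by omega))
  have c2 := Omega.isConcat_concat a1 b1 (max s s1) (min r r1) (fun i hi => h2 i (by omega))
    (fun i hi => h4 i (by omega))
  rw [Omega.cls_add c1, Omega.cls_add c2]
  refine Quot.sound (Omega.linked_pair fun i => ?_)
  simp only [Omega.concat, Omega.val_mk]
  by_cases h : i + 1 ≤ max s s1 + min r r1
  · have h' : i ≤ max s s1 + min r r1 := by omega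
    simp only [h, h', if_true]
    have := Omega.pair_linked_iff.1 ha (i - min r r1)
    rwa [show i - min r r1 + 1 = i + 1 - min r r1 by ring] at this
  · have := Omega.pair_linked_iff.1 hb (i - max s s1)
    rw [show i - max s s1 + 1 = i + 1 - max s s1 by ring] at this
    by_cases h' : i ≤ max s s1 + min r r1
    · simp only [h, h', if_true, if_false]
      have k1 := (h1 (i - min r r1) (by omega)).trans (h3 (i - max s s1) (by omega)).symm
      have k2 := (h2 (i - min r r1) (by omega)).trans (h4 (i - max s s1) (by omega)).symm
      rwa [k1, k2]
    · simpa only [h, h', if_false] using this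

/-- The operation of path components of loops, induced by concatenation. -/
def Omega.mul {X : PCSpace.{u}} (x y : (Omega X).pi0) : (Omega X).pi0 :=
  Quot.lift₂ (fun a b => Omega.cls (Omega.add a b))
    (fun a _ _ h => Omega.cls_add_congr (a := a) (a1 := a)
      (by simpa using (Omega X).linked_singleton a) h)
    (fun _ _ b h => Omega.cls_add_congr (b := b) (b1 := b) h
      (by simpa using (Omega X).linked_singleton b)) x y

theorem Omega.mul_cls {X : PCSpace.{u}} {a b c : (Omega X).carrier}
    (h : Omega.IsConcat a b c) : Omega.mul (Omega.cls a) (Omega.cls b) = Omega.cls c :=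
  Omega.cls_add h

/-- The reversed loop. -/
def Omega.neg {X : PCSpace.{u}} (a : (Omega X).carrier) : (Omega X).carrier :=
  Omega.mk (fun i => Omega.val a (-i))
    (fun i => by
      have := Omega.linked_val a (-(i + 1))
      rwa [show -(i + 1) + 1 = -i by ring, Set.pair_comm] at this)
    (by
      obtain ⟨p, q, -, h1, h2⟩ := Omega.exists_support a
      exact ⟨-q, -p, fun i hi => h2 _ (by omega), fun i hi => h1 _ (by omega)⟩)

/-- Inversion of classes of loops, induced by reversion. -/
def Omega.inv {X : PCSpace.{u}} (x : (Omega X).pi0) : (Omega X).pi0 :=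
  Quot.lift (fun a => Omega.cls (Omega.neg a))
    (fun a b h => Quot.sound (Omega.linked_pair fun i => by
      have := Omega.pair_linked_iff.1 h (-(i + 1))
      rw [show -(i + 1) + 1 = -i by ring] at this
      refine this.mono ?_
      simp only [Omega.neg, Omega.val_mk]
      rintro x ((rfl | rfl) | (rfl | rfl)) <;> simp)) x

theorem Omega.mul_assoc {X : PCSpace.{u}} (x y z : (Omega X).pi0) :
    Omega.mul (Omega.mul x y) z = Omega.mul x (Omega.mul y z) := by
  obtain ⟨a, rfl⟩ := Quot.exists_rep x
  obtain ⟨b, rfl⟩ := Quot.exists_rep y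
  obtain ⟨c, rfl⟩ := Quot.exists_rep z
  obtain ⟨-, p, -, -, h1⟩ := Omega.exists_support a
  obtain ⟨q, r, hqr, h2, h3⟩ := Omega.exists_support b
  obtain ⟨s, -, -, h4, -⟩ := Omega.exists_support c
  have k1 := Omega.isConcat_concat a b p q h1 h2
  have k2 := Omega.isConcat_concat b c r s h3 h4
  have e1 : ∀ i, p + r ≤ i → Omega.val (Omega.concat a b p q h1 h2) i = X.pt := fun i hi => by
    simp only [Omega.concat, Omega.val_mk]
    split_ifs
    · exact h1 _ (by omega)
    · exact h3 _ (by omega)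
  have k3 := Omega.isConcat_concat _ c (p + r) s e1 h4
  have k4 : Omega.IsConcat a (Omega.concat b c r s h3 h4)
      (Omega.concat (Omega.concat a b p q h1 h2) c (p + r) s e1 h4) := by
    refine ⟨p, q + s, h1, fun i hi => ?_, fun i hi => ?_, fun i hi => ?_⟩
    · simp only [Omega.concat, Omega.val_mk]
      rw [if_pos (by omega)]
      exact h2 _ (by omega)
    · simp only [Omega.concat, Omega.val_mk]
      rw [if_pos (by omega), if_pos (by omega)]
      congr 1
      ring
    · simp only [Omega.concat, Omega.val_mk]
      by_cases h : i ≤ p + r + s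
      · rw [if_pos h, if_pos (by omega : i - p ≤ r + s)]
        split_ifs
        · rw [h1 _ (by omega), h2 _ (by omega)]
        · congr 1
          ring
      · rw [if_neg h, if_neg (by omega)]
        congr 1
        ring
  change Omega.mul (Omega.mul (Omega.cls a) (Omega.cls b)) (Omega.cls c) =
    Omega.mul (Omega.cls a) (Omega.mul (Omega.cls b) (Omega.cls c))
  rw [Omega.mul_cls k1, Omega.mul_cls k2, Omega.mul_cls k3, Omega.mul_cls k4]

theorem Omega.pt_mul {X : PCSpace.{u}} (x : (Omega X).pi0) :
    Omega.mul (Omega.cls (Omega X).pt) x = x := by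
  obtain ⟨a, rfl⟩ := Quot.exists_rep x
  obtain ⟨p, -, -, h, -⟩ := Omega.exists_support a
  refine Omega.mul_cls ⟨0, p, fun i _ => Omega.val_pt i, h, fun i hi => ?_, fun i _ => ?_⟩
  · rw [h i (by omega), Omega.val_pt]
  · rw [sub_zero]

theorem Omega.mul_pt {X : PCSpace.{u}} (x : (Omega X).pi0) :
    Omega.mul x (Omega.cls (Omega X).pt) = x := by
  obtain ⟨a, rfl⟩ := Quot.exists_rep x
  obtain ⟨-, q, -, -, h⟩ := Omega.exists_support a
  refine Omega.mul_cls ⟨q, 0, h, fun i _ => Omega.val_pt i, fun i hi => ?_, fun i hi => ?_⟩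
  · rw [sub_zero]
  · rw [h i (by omega), Omega.val_pt]

theorem Omega.inv_mul {X : PCSpace.{u}} (x : (Omega X).pi0) :
    Omega.mul (Omega.inv x) x = Omega.cls (Omega X).pt := by
  obtain ⟨a, rfl⟩ := Quot.exists_rep x
  obtain ⟨p, q, hpq, h1, h2⟩ := Omega.exists_support a
  have step1 : ∀ k m n : ℤ, (m = k ∨ m = k + 1) → (n = k ∨ n = k + 1) →
      ({Omega.val a m, Omega.val a n} : Set X.carrier) ⊆ {Omega.val a k, Omega.val a (k + 1)} := by
    rintro k m n (rfl | rfl) (rfl | rfl) <;> simp [Set.insert_subset_iff]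
  have link : ∀ j i : ℤ, X.Linked
      {Omega.val a (max (max i (-i)) j + p),
        Omega.val a (max (max (i + 1) (-(i + 1))) j + p)} := fun j i =>
    (Omega.linked_val a (min (max (max i (-i)) j + p) (max (max (i + 1) (-(i + 1))) j + p))).mono
      (step1 _ _ _ (by omega) (by omega))
  let c : ℤ → (Omega X).carrier := fun j =>
    Omega.mk (fun i => Omega.val a (max (max i (-i)) j + p)) (link j)
      ⟨p - q, q - p, fun i hi => h2 _ (by omega), fun i hi => h2 _ (by omega)⟩
  have step : ∀ j, Omega.cls (c j) = Omega.cls (c (j + 1)) := fun j => by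
    refine Quot.sound (Omega.linked_pair fun i => ?_)
    refine (Omega.linked_val a
      (max (min (max i (-i)) (max (i + 1) (-(i + 1)))) j + p)).mono ?_
    exact Set.union_subset (step1 _ _ _ (by omega) (by omega)) (step1 _ _ _ (by omega) (by omega))
  have all : ∀ k : ℕ, Omega.cls (c 0) = Omega.cls (c k) := fun k => by
    induction k with
    | zero => rfl
    | succ k ih => rw [ih, step]; norm_cast
  have hc : Omega.IsConcat (Omega.neg a) a (c 0) := by
    refine ⟨-p, p, fun i hi => h1 _ (by omega), h1, fun i hi => ?_, fun i hi => ?_⟩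
    · exact congrArg (Omega.val a) (by omega)
    · exact congrArg (Omega.val a) (by omega)
  have hq : c ((q - p).toNat : ℤ) = (Omega X).pt := Omega.ext fun i => h2 _ (by omega)
  change Omega.mul (Omega.cls (Omega.neg a)) (Omega.cls a) = _
  rw [Omega.mul_cls hc, all (q - p).toNat, hq]

/-- Path components of loops form a group under concatenation: `[a] * [b]` is the class of any
admissible concatenation, first `a` and then `b`. -/
instance Omega.group (X : PCSpace.{u}) : Group (Omega X).pi0 where
  mul := Omega.mul
  one := Omega.cls (Omega X).pt
  inv := Omega.inv
  mul_assoc := Omega.mul_assoc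
  one_mul := Omega.pt_mul
  mul_one := Omega.mul_pt
  inv_mul_cancel := Omega.inv_mul

/-- The map induced on loop objects. -/
def Omega.map {X Y : PCSpace.{u}} (f : PMap X Y) : PMap (Omega X) (Omega Y) where
  toFun a := Omega.mk (fun i => f.toFun (Omega.val a i))
    (fun i => by simpa only [Set.image_pair] using f.isMap _ (Omega.linked_val a i))
    (by
      obtain ⟨p, q, -, h1, h2⟩ := Omega.exists_support a
      exact ⟨p, q, fun i hi => by rw [h1 i hi, f.map_pt], fun i hi => by rw [h2 i hi, f.map_pt]⟩)
  isMap s hs := by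
    obtain ⟨hf, h⟩ := Omega.linked_iff.1 hs
    refine Omega.linked_iff.2 ⟨hf.image _, fun i => ?_⟩
    have := f.isMap _ (h i)
    rw [Set.image_iUnion₂] at this
    rw [Set.biUnion_image]
    simp only [Set.image_pair] at this
    exact this
  map_pt := Omega.ext fun _ => f.map_pt

/-- The iterated loop objects `Ω^n X`. -/
def OmegaIter : ℕ → PCSpace.{u} → PCSpace.{u}
  | 0, X => X
  | n + 1, X => Omega (OmegaIter n X)

/-- The maps induced on iterated loop objects. -/
def OmegaIter.map {X Y : PCSpace.{u}} (f : PMap X Y) :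
    (n : ℕ) → PMap (OmegaIter n X) (OmegaIter n Y)
  | 0 => f
  | n + 1 => Omega.map (OmegaIter.map f n)

/-- The intrinsic homotopy groups `π_n = π_0 Ω^n` of a pointed simplicial complex. -/
def piGroup (n : ℕ) (X : PCSpace.{u}) : Type u := (OmegaIter n X).pi0

/-- The class of an `n`-dimensional loop. -/
def piGroup.cls {n : ℕ} {X : PCSpace.{u}} (a : (OmegaIter n X).carrier) : piGroup n X :=
  Quot.mk _ a

/-- For positive `n`, the group structure induced by the concatenation of loops in
`Ω (Ω^(n-1) X)`. -/
instance piGroup.group (n : ℕ) (X : PCSpace.{u}) : Group (piGroup (n + 1) X) :=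
  Omega.group (OmegaIter n X)

/-- The action of `π_n` on pointed maps. -/
def piGroup.map (n : ℕ) {X Y : PCSpace.{u}} (f : PMap X Y) : piGroup n X → piGroup n Y :=
  Quot.map (OmegaIter.map f n).toFun fun a b h => by
    simpa only [Set.image_pair] using (OmegaIter.map f n).isMap _ h

/-- The `n`-dimensional net `ℤ^n → X` corresponding to an element of `Ω^n X`. -/
def net {X : PCSpace.{u}} : (n : ℕ) → (OmegaIter n X).carrier → (Fin n → ℤ) → X.carrier
  | 0, a, _ => a
  | n + 1, a, i => net n (Omega.val a (i 0)) (Fin.tail i)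

/-- `[p, q]^n` is an admissible support of the net of `a`, whose faces are at the base point. -/
def IsSupport {X : PCSpace.{u}} {n : ℕ} (a : (OmegaIter n X).carrier) (p q : ℤ) : Prop :=
  p ≤ q ∧ ∀ i : Fin n → ℤ, (∃ r, i r ≤ p ∨ q ≤ i r) → net n a i = X.pt

theorem net_linked {X : PCSpace.{u}} : ∀ (n : ℕ) (s : Set (OmegaIter n X).carrier),
    (OmegaIter n X).Linked s → ∀ i : Fin n → ℤ,
    X.Linked (⋃ a ∈ s, net n a '' Set.Icc i (fun r => i r + 1))
  | 0, s, hs, i => by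
    refine hs.mono ?_
    intro x hx
    obtain ⟨a, ha, -, -, rfl⟩ := Set.mem_iUnion₂.1 hx
    exact ha
  | n + 1, s, hs, i => by
    have h := net_linked n _ ((Omega.linked_iff.1 hs).2 (i 0)) (Fin.tail i)
    refine h.mono ?_
    intro x hx
    simp only [Set.mem_iUnion, Set.mem_image] at hx
    obtain ⟨a, ha, k, hk, rfl⟩ := hx
    have h0 : k 0 = i 0 ∨ k 0 = i 0 + 1 := by
      have h1 := hk.1 0
      have h2 : k 0 ≤ i 0 + 1 := hk.2 0
      have h1 : i 0 ≤ k 0 := h1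
      omega
    refine Set.mem_biUnion (x := Omega.val a (k 0)) (Set.mem_biUnion ha ?_)
      ⟨Fin.tail k, ⟨fun r => hk.1 r.succ, fun r => hk.2 r.succ⟩, rfl⟩
    rcases h0 with h0 | h0 <;> simp [h0]

/-- A net sends elementary cubes to linked parts. -/
theorem net_isMap {X : PCSpace.{u}} {n : ℕ} (a : (OmegaIter n X).carrier) (i : Fin n → ℤ) :
    X.Linked (net n a '' Set.Icc i (fun r => i r + 1)) := by
  simpa using net_linked n {a} ((OmegaIter n X).linked_singleton a) i

end PCSpace

/-! ### The geometric realisation -/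

namespace CSpace

/-- The geometric realisation: families of nonnegative barycentric coordinates with linked support
and sum `1`. -/
structure Realization (X : CSpace.{u}) : Type u where
  /-- the barycentric coordinates -/
  coords : X →₀ ℝ
  nonneg : ∀ x, 0 ≤ coords x
  linked : X.Linked (coords.support : Set X)
  sum_eq : (coords.sum fun _ c => c) = 1

namespace Realization

theorem ext {X : CSpace.{u}} {l m : Realization X} (h : ∀ x, l.coords x = m.coords x) : l = m := by
  cases l
  cases m
  congr
  exact Finsupp.ext h

/-- The inclusion of the closed simplex on a face `s`, from the standard simplex on `s`. -/
def simplexMap (X : CSpace.{u}) (s : Finset X) (hs : s ∈ X.cx) (c : stdSimplex ℝ s) :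
    Realization X where
  coords := Finsupp.embDomain (Function.Embedding.subtype (· ∈ s))
    (Finsupp.equivFunOnFinite.symm c.1)
  nonneg x := by
    by_cases hx : x ∈ s
    · have := Finsupp.embDomain_apply_self (Function.Embedding.subtype (· ∈ s))
        (Finsupp.equivFunOnFinite.symm c.1) ⟨x, hx⟩
      exact this.symm ▸ c.2.1 ⟨x, hx⟩
    · rw [Finsupp.embDomain_of_notMem_range]
      simpa using hx
  linked := by
    refine Linked.mono (s := (s : Set X)) (Or.inr ⟨s, hs, rfl⟩) ?_
    intro x hx
    rw [Finsupp.support_embDomain] at hx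
    simp only [Finset.coe_map, Set.mem_image] at hx
    obtain ⟨y, -, rfl⟩ := hx
    exact y.2
  sum_eq := by
    rw [Finsupp.embDomain_eq_mapDomain, Finsupp.sum_mapDomain_index (by simp) (by simp),
      Finsupp.sum_fintype _ _ (by simp)]
    exact c.2.2

/-- The direct limit (weak) topology defined by the closed simplices, each with its euclidean
topology. -/
instance (X : CSpace.{u}) : TopologicalSpace (Realization X) :=
  ⨆ (s : Finset X) (hs : s ∈ X.cx), TopologicalSpace.coinduced (simplexMap X s hs) inferInstance

theorem simplexMap_of_mem {X : CSpace.{u}} {s : Finset X} {hs : s ∈ X.cx} (c : stdSimplex ℝ s)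
    {x : X} (h : x ∈ s) : (simplexMap X s hs c).coords x = c.1 ⟨x, h⟩ :=
  Finsupp.embDomain_apply_self (Function.Embedding.subtype (· ∈ s))
    (Finsupp.equivFunOnFinite.symm c.1) ⟨x, h⟩

theorem simplexMap_of_notMem {X : CSpace.{u}} {s : Finset X} {hs : s ∈ X.cx}
    (c : stdSimplex ℝ s) {x : X} (h : x ∉ s) : (simplexMap X s hs c).coords x = 0 :=
  Finsupp.embDomain_of_notMem_range _ _ _ (by simpa using h)

theorem continuous_simplexMap (X : CSpace.{u}) (s : Finset X) (hs : s ∈ X.cx) :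
    Continuous (simplexMap X s hs) :=
  continuous_iff_coinduced_le.2
    (le_iSup₂_of_le (f := fun (s : Finset X) (hs : s ∈ X.cx) =>
      TopologicalSpace.coinduced (simplexMap X s hs) inferInstance) s hs le_rfl)

theorem continuous_of_simplexMap {X : CSpace.{u}} {T : Type v} [TopologicalSpace T]
    {g : Realization X → T} (h : ∀ s hs, Continuous (g ∘ simplexMap X s hs)) : Continuous g := by
  refine continuous_iSup_dom.2 fun s => continuous_iSup_dom.2 fun hs => ?_
  exact continuous_coinduced_dom.2 (h s hs)

/-- A mapping into one closed simplex is continuous if its barycentric coordinates are so. -/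
theorem continuous_of_coords {X : CSpace.{u}} {T : Type v} [TopologicalSpace T]
    {g : T → Realization X} (s : Finset X) (hs : s ∈ X.cx)
    (h0 : ∀ t, ∀ x ∉ s, (g t).coords x = 0)
    (hc : ∀ x, Continuous fun t => (g t).coords x) : Continuous g := by
  have hsum : ∀ t, ∑ x : s, (g t).coords x = 1 := fun t => by
    have h1 : (g t).coords.sum (fun _ c => c) = ∑ x ∈ s, (g t).coords x := by
      refine Finsupp.sum_of_support_subset _ ?_ _ (by simp)
      intro x hx
      by_contra hxs
      exact (Finsupp.mem_support_iff.1 hx) (h0 t x hxs)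
    rw [Finset.sum_coe_sort s fun x => (g t).coords x, ← h1, (g t).sum_eq]
  have e : g = simplexMap X s hs ∘
      fun t => ⟨fun x => (g t).coords x, fun x => (g t).nonneg x, hsum t⟩ := by
    funext t
    refine ext fun x => ?_
    by_cases h : x ∈ s
    · rw [Function.comp_apply, simplexMap_of_mem _ h]
    · rw [Function.comp_apply, simplexMap_of_notMem _ h, h0 t x h]
  rw [e]
  exact (continuous_simplexMap X s hs).comp
    (Continuous.subtype_mk (continuous_pi fun x : s => hc x) _)

/-- A vertex, as a point of the realisation. -/
def vertex {X : CSpace.{u}} (x : X) : Realization X where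
  coords := Finsupp.single x 1
  nonneg y := by
    classical
    rw [Finsupp.single_apply]
    split_ifs <;> simp
  linked := (X.linked_singleton x).mono (by simp)
  sum_eq := by simp

end Realization

end CSpace

namespace PCSpace

/-- The geometric realisation of a pointed simplicial complex. -/
abbrev geom (X : PCSpace.{u}) : Type u := CSpace.Realization X.toCSpace

/-- The base point of the geometric realisation. -/
abbrev basePt (X : PCSpace.{u}) : X.geom := CSpace.Realization.vertex (X := X.toCSpace) X.pt

/-- The continuous map of geometric realisations induced by a map, affine on each simplex. -/
def geomMap {X Y : PCSpace.{u}} (f : PMap X Y) : C(X.geom, Y.geom) where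
  toFun l :=
    { coords := l.coords.mapDomain f.toFun
      nonneg := fun y => by
        classical
        rw [Finsupp.mapDomain, Finsupp.sum_apply]
        refine Finset.sum_nonneg fun x _ => ?_
        dsimp only
        rw [Finsupp.single_apply]
        split_ifs
        · exact l.nonneg x
        · exact le_rfl
      linked := by
        classical
        refine (f.isMap _ l.linked).mono ?_
        rw [← Finset.coe_image]
        exact_mod_cast Finsupp.mapDomain_support (f := f.toFun) (s := l.coords)
      sum_eq := by
        rw [Finsupp.sum_mapDomain_index (by simp) (by simp)]
        exact l.sum_eq }
  continuous_toFun := by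
    classical
    refine CSpace.Realization.continuous_of_simplexMap fun s hs => ?_
    have hi : s.image f.toFun ∈ Y.cx := by
      refine CSpace.Linked.mem (X := Y.toCSpace) ?_
        (Finset.image_nonempty.2 (X.cx.isRelLowerSet_faces hs).1)
      rw [Finset.coe_image]
      exact f.isMap _ (Or.inr ⟨s, hs, rfl⟩)
    have e : ∀ (c : stdSimplex ℝ s) (y : Y.carrier),
        (CSpace.Realization.simplexMap X.toCSpace s hs c).coords.mapDomain f.toFun y =
          ∑ x : s, if f.toFun x = y then c.1 x else 0 := by
      intro c y
      rw [Finsupp.mapDomain, Finsupp.sum_apply, Finsupp.sum_of_support_subset (s := s)]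
      · rw [← Finset.sum_coe_sort s]
        refine Finset.sum_congr rfl fun x _ => ?_
        rw [Finsupp.single_apply, CSpace.Realization.simplexMap_of_mem _ x.2]
      · intro x hx
        by_contra hxs
        exact (Finsupp.mem_support_iff.1 hx) (CSpace.Realization.simplexMap_of_notMem _ hxs)
      · simp
    refine CSpace.Realization.continuous_of_coords _ hi (fun c y hy => ?_) (fun y => ?_)
    · refine (e c y).trans (Finset.sum_eq_zero fun x _ => if_neg ?_)
      rintro rfl
      exact hy (Finset.mem_image_of_mem _ x.2)
    · refine (continuous_congr fun c => e c y).2 (continuous_finsetSum _ fun x _ => ?_)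
      split_ifs
      · exact (continuous_apply x).comp continuous_subtype_val
      · exact continuous_const

theorem geomMap_basePt {X Y : PCSpace.{u}} (f : PMap X Y) : geomMap f X.basePt = Y.basePt := by
  refine CSpace.Realization.ext fun y => ?_
  change Finsupp.mapDomain f.toFun (Finsupp.single X.pt 1) y = Finsupp.single Y.pt 1 y
  rw [Finsupp.mapDomain_single, f.map_pt]

end PCSpace

/-- The action of the topological homotopy groups on pointed continuous maps. -/
def topPiMap (n : ℕ) {A B : Type u} [TopologicalSpace A] [TopologicalSpace B] {a : A} {b : B}
    (f : C(A, B)) (h : f a = b) : π_ n A a → π_ n B b :=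
  Quotient.map (fun g => ⟨f.comp g.1, fun y hy => by
      rw [ContinuousMap.comp_apply, g.2 y hy, h]⟩)
    fun _ _ H => ContinuousMap.HomotopicRel.comp_continuousMap H f

/-! ### Multi-affine extensions of nets -/

namespace PCSpace

/-- The barycentric coordinates of the multi-affine extension of `a` at `t`: the combination of the
vertices `a k`, for `k` in the elementary cube `∏ r, {⌊t r⌋, ⌊t r⌋ + 1}`, with the weights
`∏ r, (1 - |t r - k r|)`; here `1 - |t r - k r|` is `1 - u` for `k r = ⌊t r⌋` and `u` for
`k r = ⌊t r⌋ + 1`, where `u` is the fractional part of `t r`. -/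
def affCoords {α : Type u} {n : ℕ} (a : (Fin n → ℤ) → α) (t : Fin n → ℝ) : α →₀ ℝ :=
  ∑ k ∈ Finset.Icc (fun r => ⌊t r⌋) (fun r => ⌊t r⌋ + 1),
    Finsupp.single (a k) (∏ r, (1 - |t r - k r|))

theorem weight_eq_zero {n : ℕ} {t : Fin n → ℝ} {i j k : Fin n → ℤ}
    (hi : ∀ r, i r ≤ t r ∧ t r ≤ i r + 1) (hj : ∀ r, j r ≤ t r ∧ t r ≤ j r + 1)
    (hk : k ∈ Finset.Icc i (fun r => i r + 1)) (hkj : k ∉ Finset.Icc j (fun r => j r + 1)) :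
    ∏ r, (1 - |t r - k r|) = 0 := by
  rw [Finset.mem_Icc] at hk hkj
  have : ∃ r, k r < j r ∨ j r + 1 < k r := by
    by_contra h
    push Not at h
    exact hkj ⟨fun r => (h r).1, fun r => (h r).2⟩
  obtain ⟨r, hr⟩ := this
  refine Finset.prod_eq_zero (Finset.mem_univ r) ?_
  have h1 : i r ≤ k r := hk.1 r
  have h2 : k r ≤ i r + 1 := hk.2 r
  obtain ⟨a1, a2⟩ := hi r
  obtain ⟨a3, a4⟩ := hj r
  rcases hr with hr | hr
  · have h4 : (k r : ℝ) + 1 ≤ j r := by exact_mod_cast hr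
    have h3 : (i r : ℝ) ≤ k r := by exact_mod_cast h1
    rw [abs_of_nonneg (by linarith)]
    linarith
  · have h4 : (j r : ℝ) + 1 + 1 ≤ k r := by exact_mod_cast hr
    have h3 : (k r : ℝ) ≤ i r + 1 := by exact_mod_cast h2
    rw [abs_of_nonpos (by linarith)]
    linarith

/-- On each closed elementary cube containing `t` the same formula holds. -/
theorem affCoords_eq {α : Type u} {n : ℕ} (a : (Fin n → ℤ) → α) {t : Fin n → ℝ} {i : Fin n → ℤ}
    (hi : ∀ r, i r ≤ t r ∧ t r ≤ i r + 1) :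
    affCoords a t = ∑ k ∈ Finset.Icc i (fun r => i r + 1),
      Finsupp.single (a k) (∏ r, (1 - |t r - k r|)) := by
  classical
  have hj : ∀ r, (⌊t r⌋ : ℝ) ≤ t r ∧ t r ≤ ⌊t r⌋ + 1 := fun r =>
    ⟨Int.floor_le _, (Int.lt_floor_add_one _).le⟩
  rw [affCoords, Finset.sum_subset (Finset.subset_union_left
      (s₂ := Finset.Icc i (fun r => i r + 1))) (fun k hk hk' => ?_),
    ← Finset.sum_subset (Finset.subset_union_right
      (s₁ := Finset.Icc (fun r => ⌊t r⌋) (fun r => ⌊t r⌋ + 1))) (fun k hk hk' => ?_)]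
  · rw [weight_eq_zero hj hi ((Finset.mem_union.1 hk).resolve_right hk') hk', Finsupp.single_zero]
  · rw [weight_eq_zero hi hj ((Finset.mem_union.1 hk).resolve_left hk') hk', Finsupp.single_zero]

theorem floor_bounds {n : ℕ} (t : Fin n → ℝ) (r : Fin n) :
    (⌊t r⌋ : ℝ) ≤ t r ∧ t r ≤ ⌊t r⌋ + 1 :=
  ⟨Int.floor_le _, (Int.lt_floor_add_one _).le⟩

theorem weight_nonneg {n : ℕ} {t : Fin n → ℝ} {i k : Fin n → ℤ}
    (hi : ∀ r, i r ≤ t r ∧ t r ≤ i r + 1) (hk : k ∈ Finset.Icc i (fun r => i r + 1)) :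
    0 ≤ ∏ r, (1 - |t r - k r|) := by
  rw [Finset.mem_Icc] at hk
  refine Finset.prod_nonneg fun r _ => ?_
  have h1 : i r ≤ k r := hk.1 r
  have h2 : k r ≤ i r + 1 := hk.2 r
  have h3 : (i r : ℝ) ≤ k r := by exact_mod_cast h1
  have h4 : (k r : ℝ) ≤ i r + 1 := by exact_mod_cast h2
  obtain ⟨a1, a2⟩ := hi r
  rw [sub_nonneg, abs_le]
  constructor <;> linarith

theorem weight_sum {n : ℕ} {t : Fin n → ℝ} {i : Fin n → ℤ}
    (hi : ∀ r, i r ≤ t r ∧ t r ≤ i r + 1) :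
    ∑ k ∈ Finset.Icc i (fun r => i r + 1), ∏ r, (1 - |t r - k r|) = 1 := by
  have e : Finset.Icc i (fun r => i r + 1) = Fintype.piFinset fun r => Finset.Icc (i r) (i r + 1) :=
    rfl
  rw [e, ← Finset.prod_univ_sum (fun r => Finset.Icc (i r) (i r + 1))
    (fun r (m : ℤ) => 1 - |t r - m|)]
  refine Finset.prod_eq_one fun r _ => ?_
  have e2 : Finset.Icc (i r) (i r + 1) = {i r, i r + 1} := by
    ext m
    simp only [Finset.mem_Icc, Finset.mem_insert, Finset.mem_singleton]
    omega
  obtain ⟨a1, a2⟩ := hi r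
  rw [e2, Finset.sum_pair (by omega), abs_of_nonneg (by linarith),
    abs_of_nonpos (by push_cast; linarith)]
  push_cast
  ring

theorem affCoords_apply_of_notMem {α : Type u} {n : ℕ} (a : (Fin n → ℤ) → α) {t : Fin n → ℝ}
    {i : Fin n → ℤ} (hi : ∀ r, i r ≤ t r ∧ t r ≤ i r + 1) {x : α}
    (hx : x ∉ a '' Set.Icc i (fun r => i r + 1)) : affCoords a t x = 0 := by
  rw [affCoords_eq a hi, Finsupp.finsetSum_apply]
  refine Finset.sum_eq_zero fun k hk => Finsupp.single_eq_of_ne ?_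
  rintro rfl
  exact hx ⟨k, by simpa using hk, rfl⟩

/-- The point of the realisation with the coordinates `affCoords`. -/
def affPoint {X : PCSpace.{u}} {n : ℕ} (a : (OmegaIter n X).carrier) (t : Fin n → ℝ) : X.geom where
  coords := affCoords (net n a) t
  nonneg x := by
    classical
    rw [affCoords, Finsupp.finsetSum_apply]
    refine Finset.sum_nonneg fun k hk => ?_
    rw [Finsupp.single_apply]
    split_ifs
    · exact weight_nonneg (floor_bounds t) hk
    · exact le_rfl
  linked := by
    refine (net_isMap a fun r => ⌊t r⌋).mono fun x hx => ?_
    by_contra h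
    exact (Finsupp.mem_support_iff.1 hx) (affCoords_apply_of_notMem _ (floor_bounds t) h)
  sum_eq := by
    rw [affCoords, ← Finsupp.sum_finsetSum_index (by simp) (by simp)]
    simp only [Finsupp.sum_single_index]
    exact weight_sum (floor_bounds t)

theorem locallyFinite_cubes (n : ℕ) : LocallyFinite fun i : Fin n → ℤ =>
    {t : Fin n → ℝ | ∀ r, i r ≤ t r ∧ t r ≤ i r + 1} := by
  intro t
  refine ⟨{s | ∀ r, t r - 1 < s r ∧ s r < t r + 1}, ?_, ?_⟩
  · have : {s : Fin n → ℝ | ∀ r, t r - 1 < s r ∧ s r < t r + 1} =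
        Set.pi Set.univ fun r => Set.Ioo (t r - 1) (t r + 1) := by
      ext s
      simp
    rw [this]
    exact set_pi_mem_nhds Set.finite_univ fun r _ => Ioo_mem_nhds (by linarith) (by linarith)
  · refine (Set.finite_Icc (fun r => ⌊t r⌋ - 2) (fun r => ⌊t r⌋ + 2)).subset ?_
    rintro i ⟨s, h1, h2⟩
    refine ⟨fun r => ?_, fun r => ?_⟩
    · have := (h1 r).2
      have := (h2 r).1
      have : (⌊t r⌋ : ℝ) - 2 ≤ i r := by linarith [Int.floor_le (t r)]
      exact_mod_cast this
    · have := (h1 r).1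
      have := (h2 r).2
      have : (i r : ℝ) < ⌊t r⌋ + 2 := by linarith [Int.lt_floor_add_one (t r)]
      have : i r < ⌊t r⌋ + 2 := by exact_mod_cast this
      exact this.le

/-- The multi-affine extension of a net: the continuous mapping extending the net which is affine
in each variable on all elementary cubes. -/
def affExt {X : PCSpace.{u}} {n : ℕ} (a : (OmegaIter n X).carrier) : C(Fin n → ℝ, X.geom) where
  toFun := affPoint a
  continuous_toFun := by
    classical
    refine (locallyFinite_cubes n).continuous ?_ (fun i => ?_) (fun i => ?_)
    · refine Set.eq_univ_of_forall fun t => Set.mem_iUnion.2 ⟨fun r => ⌊t r⌋, floor_bounds t⟩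
    · simp only [Set.ofPred_forall]
      refine isClosed_iInter fun r => ?_
      exact (isClosed_le continuous_const (continuous_apply r)).inter
        (isClosed_le (continuous_apply r) continuous_const)
    · rw [continuousOn_iff_continuous_domRestrict]
      have hl := net_isMap a i
      have hs : hl.finite.toFinset ∈ X.cx := by
        refine CSpace.Linked.mem (X := X.toCSpace) (by simpa using hl) ?_
        exact ⟨net n a i, by simpa using ⟨i, ⟨le_rfl, fun r => by simp⟩, rfl⟩⟩
      refine CSpace.Realization.continuous_of_coords _ hs (fun t x hx => ?_) (fun x => ?_)
      · exact affCoords_apply_of_notMem _ t.2 (by simpa using hx)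
      · have e : ∀ t : {t : Fin n → ℝ | ∀ r, i r ≤ t r ∧ t r ≤ i r + 1},
            affCoords (net n a) t.1 x = ∑ k ∈ Finset.Icc i (fun r => i r + 1),
              if net n a k = x then ∏ r, (1 - |t.1 r - k r|) else 0 := fun t => by
          rw [affCoords_eq _ t.2, Finsupp.finsetSum_apply]
          exact Finset.sum_congr rfl fun k _ => Finsupp.single_apply
        refine (continuous_congr fun t => e t).2 (continuous_finsetSum _ fun k _ => ?_)
        split_ifs
        · refine continuous_finsetProd _ fun r _ => ?_
          exact continuous_const.sub
            (((continuous_apply r).comp continuous_subtype_val).sub continuous_const).abs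
        · exact continuous_const

theorem affExt_face {X : PCSpace.{u}} {n : ℕ} {a : (OmegaIter n X).carrier} {p q : ℤ}
    (h : IsSupport a p q) {t : Fin n → ℝ} {r : Fin n} (ht : t r = p ∨ t r = q) :
    affExt a t = X.basePt := by
  classical
  refine CSpace.Realization.ext fun x => ?_
  change affCoords (net n a) t x = Finsupp.single X.pt 1 x
  congr 1
  have hc : ∀ k ∈ Finset.Icc (fun r => ⌊t r⌋) (fun r => ⌊t r⌋ + 1),
      Finsupp.single (net n a k) (∏ r, (1 - |t r - k r|)) =
        Finsupp.single X.pt (∏ r, (1 - |t r - k r|)) := by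
    intro k hk
    by_cases hkr : k r ≤ p ∨ q ≤ k r
    · rw [h.2 k ⟨r, hkr⟩]
    · push Not at hkr
      have h1 := (Finset.mem_Icc.1 hk).1 r
      have h2 := (Finset.mem_Icc.1 hk).2 r
      have : ∏ r, (1 - |t r - k r|) = 0 := by
        refine Finset.prod_eq_zero (Finset.mem_univ r) ?_
        rcases ht with ht | ht
        · simp only [ht, Int.floor_intCast] at h1 h2
          have : k r = p + 1 := by omega
          simp [ht, this]
        · simp only [ht, Int.floor_intCast] at h1 h2
          omega
      rw [this, Finsupp.single_zero, Finsupp.single_zero]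
  rw [affCoords, Finset.sum_congr rfl hc]
  exact (map_sum (Finsupp.singleAddHom X.pt) _ _).symm.trans
    (congrArg (Finsupp.single X.pt) (weight_sum (floor_bounds t)))

/-- The `n`-dimensional loop of the realisation given by the multi-affine extension of a net with
support `[p, q]^n`, reparametrised on the unit cube. -/
def affLoop {X : PCSpace.{u}} {n : ℕ} (a : (OmegaIter n X).carrier) (p q : ℤ)
    (h : IsSupport a p q) : Ω^ (Fin n) X.geom X.basePt :=
  ⟨(affExt a).comp ⟨fun t r => (p : ℝ) + (q - p) * (t r : ℝ), by fun_prop⟩, by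
    rintro t ⟨r, hr⟩
    refine affExt_face h (r := r) ?_
    rcases hr with hr | hr
    · left
      simp [hr]
    · right
      simp [hr]⟩

theorem net_pt {X : PCSpace.{u}} : ∀ (n : ℕ) (i : Fin n → ℤ), net n (OmegaIter n X).pt i = X.pt
  | 0, _ => rfl
  | n + 1, i => net_pt n (Fin.tail i)

/-- Every net with trivial faces has an admissible support. -/
theorem exists_isSupport {X : PCSpace.{u}} : ∀ (n : ℕ) (a : (OmegaIter n X).carrier),
    ∃ p q : ℤ, p < q ∧ IsSupport a p q
  | 0, _ => ⟨0, 1, one_pos, by omega, fun _ ⟨r, _⟩ => r.elim0⟩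
  | n + 1, a => by
    obtain ⟨p0, q0, h0, h1, h2⟩ := Omega.exists_support a
    choose P Q _ hs using fun j : ℤ => exists_isSupport n (Omega.val a j)
    obtain ⟨m, hm⟩ := ((Set.finite_Icc p0 q0).image P).bddBelow
    obtain ⟨M, hM⟩ := ((Set.finite_Icc p0 q0).image Q).bddAbove
    refine ⟨min p0 m - 1, max q0 M, by omega, by omega, fun i hi => ?_⟩
    change net n (Omega.val a (i 0)) (Fin.tail i) = X.pt
    by_cases hl : i 0 ≤ p0
    · rw [h1 _ hl, net_pt]
    by_cases hu : q0 ≤ i 0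
    · rw [h2 _ hu, net_pt]
    have k1 : m ≤ P (i 0) := hm ⟨i 0, ⟨by omega, by omega⟩, rfl⟩
    have k2 : Q (i 0) ≤ M := hM ⟨i 0, ⟨by omega, by omega⟩, rfl⟩
    obtain ⟨r, hr⟩ := hi
    induction r using Fin.cases with
    | zero => omega
    | succ r => exact (hs (i 0)).2 _ ⟨r, by simp only [Fin.tail]; omega⟩

end PCSpace

end

/-! The combinatorial and the topological groups agree because a continuous map on a cube can be
replaced by a net on a fine grid, and because refining the grid does not change the class of a net.

The comparison is well defined for two reasons. Enlarging the support of a net only moves the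
parameter of its extension linearly (`affLoop_homotopic_of_isSupport`). Linked nets send each
elementary cube into a common simplex, so their extensions are joined by segments
(`homotopicRel_of_linked`). The weak topology makes the continuity of the latter homotopy a real
question; it is settled by the fact that a compact set meets finitely many vertices, after which
barycentric coordinates decide continuity.

Surjectivity is simplicial approximation. A Lebesgue number for the cover by open stars gives a grid
on which choosing a star for each node yields a net; its extension lies at each point in a common
simplex with the given loop. Injectivity applies the same choice to a homotopy on `I × I^n`: its
slices are nets, consecutive slices are linked, and so the two end slices have the same class. An
end slice is only an approximation of the original net on a finer grid. It is linked to the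
subdivision of that net (`cls_eq_of_approximation`), and subdivision, being a reparametrisation of
`ℤ` with jumps at most one, preserves the class (`IsReparam.cls_eq`).

Concatenated nets become concatenated loops once the box which they occupy is rescaled to the unit
cube (`comparison_cls_concat`), and naturality holds already for the extensions themselves
(`affExt_map`). -/

noncomputable section

/-! ### The weak topology and homotopies inside common simplices -/

namespace CSpace.Realization

/-- Each closed simplex involves finitely many weights, so no bound on `w` is needed. This freedom
is what makes compact sets small: an unbounded choice of `w` detects infinitely many vertices. -/
theorem continuous_weightedSum {X : CSpace.{u}} (w : X → ℝ) :
    Continuous fun l : Realization X => l.coords.sum fun x c => c * w x := by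
  refine continuous_of_simplexMap fun s hs => ?_
  have e : ∀ c : stdSimplex ℝ s,
      ((simplexMap X s hs c).coords.sum fun x c => c * w x) = ∑ x : s, c.1 x * w x := by
    intro c
    rw [Finsupp.sum_of_support_subset (s := s)]
    · rw [← Finset.sum_coe_sort s]
      exact Finset.sum_congr rfl fun x _ => by rw [simplexMap_of_mem _ x.2]
    · intro x hx
      by_contra hxs
      exact (Finsupp.mem_support_iff.1 hx) (simplexMap_of_notMem _ hxs)
    · simp
  refine (continuous_congr e).2 (continuous_finsetSum _ fun x _ => ?_)
  exact ((continuous_apply x).comp continuous_subtype_val).mul continuous_const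

theorem continuous_coords_apply {X : CSpace.{u}} (x : X) :
    Continuous fun l : Realization X => l.coords x := by
  classical
  refine (continuous_congr fun l => ?_).2 (continuous_weightedSum fun y => if y = x then 1 else 0)
  simp [Finsupp.sum]

/-- A compact part of the realisation involves finitely many vertices only. -/
theorem exists_finset_of_isCompact {X : CSpace.{u}} {K : Set (Realization X)} (hK : IsCompact K) :
    ∃ V : Finset X, ∀ l ∈ K, l.coords.support ⊆ V := by
  classical
  by_cases hfin : (⋃ l ∈ K, (l.coords.support : Set X)).Finite
  · refine ⟨hfin.toFinset, fun l hl x hx => ?_⟩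
    simp only [Set.Finite.mem_toFinset, Set.mem_iUnion]
    exact ⟨l, hl, hx⟩
  exfalso
  have e := Set.Infinite.natEmbedding _ hfin
  have hm : ∀ k, ∃ l ∈ K, (e k).1 ∈ l.coords.support := fun k => by
    obtain ⟨l, hl, h⟩ := Set.mem_iUnion₂.1 (e k).2
    exact ⟨l, hl, h⟩
  choose m hmK hm using hm
  -- The weight of the `k`-th vertex is scaled so that this vertex alone contributes `k` to the
  -- weighted sum at `m k`; the sum is then continuous and unbounded on `K`.
  let w : X → ℝ := Function.extend (fun k => (e k).1) (fun k => k / (m k).coords (e k).1) 0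
  have hinj : Function.Injective fun k => (e k).1 := Subtype.val_injective.comp e.injective
  have hpos : ∀ k, 0 < (m k).coords (e k).1 := fun k =>
    lt_of_le_of_ne ((m k).nonneg _) (Finsupp.mem_support_iff.1 (hm k)).symm
  have hw : ∀ k, w (e k).1 = k / (m k).coords (e k).1 := fun k => hinj.extend_apply _ _ k
  have hw0 : ∀ x, 0 ≤ w x := by
    intro x
    by_cases hx : ∃ k, (e k).1 = x
    · obtain ⟨k, rfl⟩ := hx
      rw [hw]
      exact div_nonneg k.cast_nonneg (hpos k).le
    · exact ((Function.extend_apply' _ _ x hx : w x = (0 : X → ℝ) x)).ge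
  obtain ⟨B, hB⟩ := (hK.image (continuous_weightedSum w)).bddAbove
  obtain ⟨k, hk⟩ := exists_nat_gt B
  refine absurd (hB ⟨m k, hmK k, rfl⟩) (not_le.2 (hk.trans_le ?_))
  have h1 : (m k).coords (e k).1 * w (e k).1 = k := by
    rw [hw, mul_div_cancel₀ _ (hpos k).ne']
  exact h1.symm.trans_le (Finset.single_le_sum (f := fun x => (m k).coords x * w x)
    (fun x _ => mul_nonneg ((m k).nonneg x) (hw0 x)) (hm k))

theorem support_nonempty {X : CSpace.{u}} (l : Realization X) : l.coords.support.Nonempty := by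
  rw [Finset.nonempty_iff_ne_empty]
  intro h
  have := l.sum_eq
  rw [Finsupp.sum, h, Finset.sum_empty] at this
  exact zero_ne_one this

/-- A mapping involving finitely many vertices is continuous if its barycentric coordinates are
so. -/
theorem continuous_of_coords_of_finset {X : CSpace.{u}} {T : Type v} [TopologicalSpace T]
    {g : T → Realization X} (V : Finset X) (h0 : ∀ t, (g t).coords.support ⊆ V)
    (hc : ∀ x, Continuous fun t => (g t).coords x) : Continuous g := by
  classical
  -- There are finitely many faces with vertices in `V`; the conditions of lying in one of them form
  -- a finite closed cover of `T`, and on each member the map goes into a single closed simplex.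
  let F : {s : Finset X // s ∈ V.powerset ∧ s ∈ X.cx} → Set T :=
    fun s => {t | ∀ x ∉ s.1, (g t).coords x = 0}
  have hfin : Finite {s : Finset X // s ∈ V.powerset ∧ s ∈ X.cx} :=
    (V.powerset.finite_toSet.subset fun s hs => hs.1 :
      {s : Finset X | s ∈ V.powerset ∧ s ∈ X.cx}.Finite)
  refine (locallyFinite_of_finite F).continuous ?_ (fun s => ?_) fun s => ?_
  · refine Set.eq_univ_of_forall fun t => Set.mem_iUnion.2 ⟨⟨(g t).coords.support,
      Finset.mem_powerset.2 (h0 t), (g t).linked.mem (support_nonempty _)⟩, fun x hx => ?_⟩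
    simpa using hx
  · simp only [F, Set.ofPred_forall]
    exact isClosed_iInter fun x => isClosed_iInter fun _ => isClosed_eq (hc x) continuous_const
  · rw [continuousOn_iff_continuous_domRestrict]
    exact continuous_of_coords s.1 s.2.2 (fun t => t.2) fun x =>
      (hc x).comp continuous_subtype_val

/-- The point dividing the segment between two points of a common simplex. -/
def segment {X : CSpace.{u}} (l m : Realization X)
    (h : X.Linked (l.coords.support ∪ m.coords.support)) (s : unitInterval) : Realization X where
  coords := (1 - (s : ℝ)) • l.coords + (s : ℝ) • m.coords
  nonneg x := by
    have h1 := l.nonneg x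
    have h2 := m.nonneg x
    have h3 : 0 ≤ 1 - (s : ℝ) := unitInterval.one_minus_nonneg s
    have h4 : 0 ≤ (s : ℝ) := s.2.1
    simp only [Finsupp.add_apply, Finsupp.smul_apply, smul_eq_mul]
    positivity
  linked := by
    classical
    refine h.mono fun x hx => ?_
    rw [← Finset.coe_union]
    exact (Finsupp.support_add.trans (Finset.union_subset_union Finsupp.support_smul
      Finsupp.support_smul)) hx
  sum_eq := by
    rw [Finsupp.sum_add_index' (by simp) (by simp), Finsupp.sum_smul_index' (by simp),
      Finsupp.sum_smul_index' (by simp)]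
    simp only [smul_eq_mul]
    rw [← Finsupp.mul_sum, ← Finsupp.mul_sum, l.sum_eq, m.sum_eq]
    ring

/-- Two mappings on a compact space, which send each point into a common simplex, are homotopic
relatively to any part where they coincide. -/
theorem homotopicRel_of_linked {X : CSpace.{u}} {T : Type v} [TopologicalSpace T] [CompactSpace T]
    (f g : C(T, Realization X))
    (h : ∀ t, X.Linked ((f t).coords.support ∪ (g t).coords.support)) (S : Set T)
    (hS : ∀ t ∈ S, f t = g t) : f.HomotopicRel g S := by
  classical
  -- Compactness of `T` confines both maps to finitely many vertices, hence also the segments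
  -- between them.
  obtain ⟨V, hV⟩ := exists_finset_of_isCompact (isCompact_range f.continuous)
  obtain ⟨W, hW⟩ := exists_finset_of_isCompact (isCompact_range g.continuous)
  have e : ∀ (p : unitInterval × T) x, (segment (f p.2) (g p.2) (h p.2) p.1).coords x =
      (1 - (p.1 : ℝ)) * (f p.2).coords x + (p.1 : ℝ) * (g p.2).coords x := fun p x => rfl
  refine ⟨⟨⟨⟨fun p => segment (f p.2) (g p.2) (h p.2) p.1, ?_⟩, fun t => ?_, fun t => ?_⟩,
    fun s t ht => ?_⟩⟩
  · refine continuous_of_coords_of_finset (V ∪ W) (fun p => ?_) fun x => ?_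
    · exact (Finsupp.support_add.trans (Finset.union_subset_union
        (Finsupp.support_smul.trans (hV _ ⟨p.2, rfl⟩))
        (Finsupp.support_smul.trans (hW _ ⟨p.2, rfl⟩))))
    · refine (continuous_congr fun p => e p x).2 ?_
      have h1 := ((continuous_coords_apply x).comp f.continuous).comp
        (continuous_snd (X := unitInterval))
      have h2 := ((continuous_coords_apply x).comp g.continuous).comp
        (continuous_snd (X := unitInterval))
      have h3 : Continuous fun p : unitInterval × T => (p.1 : ℝ) :=
        continuous_subtype_val.comp continuous_fst
      exact ((continuous_const.sub h3).mul h1).add (h3.mul h2)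
  · refine ext fun x => (e _ x).trans ?_
    simp
  · refine ext fun x => (e _ x).trans ?_
    simp
  · refine ext fun x => (e _ x).trans ?_
    change _ = (f t).coords x
    rw [hS t ht]
    ring

/-- Uniformly small parts are sent into the open star of a vertex. -/
theorem exists_star_of_dist_lt {X : CSpace.{u}} {T : Type v} [PseudoMetricSpace T] [CompactSpace T]
    (f : C(T, Realization X)) :
    ∃ δ > 0, ∀ t, ∃ x, ∀ t', dist t' t < δ → 0 < (f t').coords x := by
  -- The open stars cover because coordinates sum to one, so at each point some coordinate is
  -- positive.
  obtain ⟨δ, hδ, h⟩ := lebesgue_number_lemma_of_metric (s := Set.univ) isCompact_univ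
    (c := fun x : X => {t | 0 < (f t).coords x})
    (fun x => isOpen_lt continuous_const ((continuous_coords_apply x).comp f.continuous))
    (fun t _ => by
      obtain ⟨x, hx⟩ := support_nonempty (f t)
      exact Set.mem_iUnion.2 ⟨x, lt_of_le_of_ne ((f t).nonneg x)
        (Finsupp.mem_support_iff.1 hx).symm⟩)
  exact ⟨δ, hδ, fun t => (h t trivial).imp fun x hx t' ht' => hx (Metric.mem_ball.2 ht')⟩

/-- An open star contains no vertex besides its centre. This forces an approximation to take the
base point wherever the approximated map does. -/
theorem eq_of_vertex_coords_pos {X : CSpace.{u}} {x y : X}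
    (h : 0 < (vertex (X := X) x).coords y) : y = x := by
  classical
  by_contra hne
  have : (vertex (X := X) x).coords y = 0 := Finsupp.single_eq_of_ne hne
  exact h.ne' this

end CSpace.Realization

/-! ### Iterated loops as mappings on `ℤ^n` -/

namespace PCSpace

theorem net_succ {X : PCSpace.{u}} {n : ℕ} (a : (OmegaIter (n + 1) X).carrier)
    (i : Fin (n + 1) → ℤ) : net (n + 1) a i = net n (Omega.val a (i 0)) (Fin.tail i) := rfl

theorem net_injective {X : PCSpace.{u}} : ∀ {n : ℕ} {a b : (OmegaIter n X).carrier},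
    (∀ i, net n a i = net n b i) → a = b
  | 0, _, _, h => h Fin.elim0
  | n + 1, a, b, h => Omega.ext fun j => net_injective fun i => by
      simpa [net_succ] using h (Fin.cons j i)

/-- A finite set of nets is linked when it sends elementary cubes to linked parts. -/
theorem linked_of_net {X : PCSpace.{u}} : ∀ {n : ℕ} {s : Set (OmegaIter n X).carrier}, s.Finite →
    (∀ i : Fin n → ℤ, X.Linked (⋃ a ∈ s, net n a '' Set.Icc i (fun r => i r + 1))) →
    (OmegaIter n X).Linked s
  | 0, s, _, h => by
    refine (h Fin.elim0).mono fun a ha => Set.mem_biUnion ha ?_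
    exact ⟨Fin.elim0, ⟨fun r => r.elim0, fun r => r.elim0⟩, rfl⟩
  | n + 1, s, hs, h => by
    refine Omega.linked_iff.2 ⟨hs, fun j => linked_of_net (hs.biUnion fun _ _ => Set.toFinite _)
      fun i => ?_⟩
    refine (h (Fin.cons j i)).mono ?_
    intro x hx
    simp only [Set.mem_iUnion] at hx
    obtain ⟨b, ⟨a, ha, hb⟩, k, hk, rfl⟩ := hx
    -- The slices at `j` and `j + 1` of an elementary cube of dimension `n` both lie in the
    -- elementary cube of dimension `n + 1` at `Fin.cons j i`.
    have key : ∀ m : ℤ, j ≤ m → m ≤ j + 1 → b = Omega.val a m → net n b k ∈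
        ⋃ a ∈ s, net (n + 1) a '' Set.Icc (Fin.cons j i)
          (fun r => (Fin.cons j i : Fin (n + 1) → ℤ) r + 1) := by
      rintro m h1 h2 rfl
      refine Set.mem_biUnion ha ⟨Fin.cons m k, ⟨fun r => ?_, fun r => ?_⟩, rfl⟩
      · induction r using Fin.cases with
        | zero => exact h1
        | succ r => exact hk.1 r
      · induction r using Fin.cases with
        | zero => exact h2
        | succ r => exact hk.2 r
    rcases hb with hb | hb
    · exact key j le_rfl (by omega) hb
    · exact key (j + 1) (by omega) le_rfl hb

theorem linked_pair_of_net {X : PCSpace.{u}} {n : ℕ} {a b : (OmegaIter n X).carrier}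
    (h : ∀ i : Fin n → ℤ, X.Linked (net n a '' Set.Icc i (fun r => i r + 1) ∪
      net n b '' Set.Icc i (fun r => i r + 1))) : (OmegaIter n X).Linked {a, b} :=
  linked_of_net (Set.toFinite _) fun i => by simpa only [Set.biUnion_pair] using h i

theorem cls_eq_of_net {X : PCSpace.{u}} {n : ℕ} {a b : (OmegaIter n X).carrier}
    (h : ∀ i : Fin n → ℤ, X.Linked (net n a '' Set.Icc i (fun r => i r + 1) ∪
      net n b '' Set.Icc i (fun r => i r + 1))) : piGroup.cls a = piGroup.cls b :=
  Quot.sound (linked_pair_of_net h)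

/-- A mapping `ℤ^n → X` which preserves linked parts and has a support is a net. -/
theorem exists_net {X : PCSpace.{u}} : ∀ {n : ℕ} (f : (Fin n → ℤ) → X.carrier),
    (∀ i, X.Linked (f '' Set.Icc i (fun r => i r + 1))) →
    ∀ p q : ℤ, (∀ i, (∃ r, i r ≤ p ∨ q ≤ i r) → f i = X.pt) →
    ∃ a : (OmegaIter n X).carrier, ∀ i, net n a i = f i
  | 0, f, _, _, _, _ => ⟨f Fin.elim0, fun i => congrArg f (Subsingleton.elim _ _)⟩
  | n + 1, f, hf, p, q, h => by
    have sub : ∀ (j m : ℤ) (i : Fin n → ℤ), j ≤ m → m ≤ j + 1 →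
        (fun k : Fin n → ℤ => f (Fin.cons m k)) '' Set.Icc i (fun r => i r + 1) ⊆
          f '' Set.Icc (Fin.cons j i) (fun r => (Fin.cons j i : Fin (n + 1) → ℤ) r + 1) := by
      rintro j m i h1 h2 _ ⟨k, hk, rfl⟩
      refine ⟨Fin.cons m k, ⟨fun r => ?_, fun r => ?_⟩, rfl⟩
      · induction r using Fin.cases with
        | zero => exact h1
        | succ r => exact hk.1 r
      · induction r using Fin.cases with
        | zero => exact h2
        | succ r => exact hk.2 r
    have ex : ∀ j : ℤ, ∃ a : (OmegaIter n X).carrier, ∀ i, net n a i = f (Fin.cons j i) := fun j =>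
      exists_net (fun i => f (Fin.cons j i))
        (fun i => (hf (Fin.cons j i)).mono (sub j j i le_rfl (by omega))) p q
        fun i ⟨r, hr⟩ => h _ ⟨r.succ, by simpa using hr⟩
    choose a ha using ex
    -- A slice outside the support is the constant net as an element of `Ω^n X`, not merely
    -- pointwise; this needs that elements are determined by their nets.
    have ha0 : ∀ j, (j ≤ p ∨ q ≤ j) → a j = (OmegaIter n X).pt := fun j hj =>
      net_injective fun i => by
        rw [ha, net_pt, h _ ⟨0, by simpa using hj⟩]
    refine ⟨Omega.mk a (fun j => linked_pair_of_net fun i => ?_) ⟨p, q, fun j hj => ha0 j (Or.inl hj),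
      fun j hj => ha0 j (Or.inr hj)⟩, fun i => ?_⟩
    · rw [funext (ha j), funext (ha (j + 1))]
      exact (hf (Fin.cons j i)).mono
        (Set.union_subset (sub j j i le_rfl (by omega)) (sub j (j + 1) i (by omega) le_rfl))
    · exact (ha _ _).trans (congrArg f (Fin.cons_self_tail i))

/-! ### Reparametrisation of nets -/

/-- A mapping `ℤ → ℤ` with jumps at most one, whose values are outside of `]p, q[` far enough: on
the left of this interval at `-∞` and on the right at `+∞`. -/
structure IsReparam (p q : ℤ) (φ : ℤ → ℤ) : Prop where
  up : ∀ i, φ (i + 1) ≤ φ i + 1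
  down : ∀ i, φ i ≤ φ (i + 1) + 1
  lower : ∃ P, ∀ i ≤ P, φ i ≤ p
  upper : ∃ Q, ∀ i, Q ≤ i → q ≤ φ i

theorem IsReparam.exists_net {X : PCSpace.{u}} {n : ℕ} {a : (OmegaIter n X).carrier} {p q : ℤ}
    (h : IsSupport a p q) {φ : ℤ → ℤ} (hφ : IsReparam p q φ) :
    ∃ b : (OmegaIter n X).carrier, ∀ i, net n b i = net n a (fun r => φ (i r)) := by
  obtain ⟨P, hP⟩ := hφ.lower
  obtain ⟨Q, hQ⟩ := hφ.upper
  refine PCSpace.exists_net (fun i => net n a (fun r => φ (i r))) (fun i => ?_) P Q ?_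
  -- Jumps at most one, in either direction, send an elementary cube into the one whose lower corner
  -- is the smaller of the two values in each coordinate.
  · refine (net_isMap a fun r => min (φ (i r)) (φ (i r + 1))).mono ?_
    rintro _ ⟨k, hk, rfl⟩
    refine ⟨_, ⟨fun r => ?_, fun r => ?_⟩, rfl⟩
    all_goals
      have h1 : i r ≤ k r := hk.1 r
      have h2 : k r ≤ i r + 1 := hk.2 r
      have h3 := hφ.up (i r)
      have h4 := hφ.down (i r)
      have h5 : k r = i r ∨ k r = i r + 1 := by omega
      rcases h5 with h5 | h5 <;> simp only [h5] <;> omega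
  · rintro i ⟨r, hr | hr⟩
    · exact h.2 _ ⟨r, Or.inl (hP _ hr)⟩
    · exact h.2 _ ⟨r, Or.inr (hQ _ hr)⟩

/-- Two reparametrisations need not be comparable; their maximum lies above both and reduces the
general case to the ordered one. -/
theorem IsReparam.sup {p q : ℤ} {φ ψ : ℤ → ℤ} (hφ : IsReparam p q φ) (hψ : IsReparam p q ψ) :
    IsReparam p q fun i => max (φ i) (ψ i) := by
  obtain ⟨P, hP⟩ := hφ.lower
  obtain ⟨Q, hQ⟩ := hφ.upper
  obtain ⟨P1, hP1⟩ := hψ.lower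
  refine ⟨fun i => ?_, fun i => ?_, ⟨min P P1, fun i hi => ?_⟩, ⟨Q, fun i hi => ?_⟩⟩
  · have := hφ.up i
    have := hψ.up i
    omega
  · have := hφ.down i
    have := hψ.down i
    omega
  · have := hP i (by omega)
    have := hP1 i (by omega)
    omega
  · have := hQ i hi
    omega

/-- The mappings interpolating between two reparametrisations. -/
theorem IsReparam.interpolate {p q k : ℤ} {φ ψ : ℤ → ℤ} (hφ : IsReparam p q φ)
    (hψ : IsReparam p q ψ) : IsReparam p q fun i => min (ψ i) (max (φ i) k) := by
  obtain ⟨P, hP⟩ := hψ.lower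
  obtain ⟨Q, hQ⟩ := hφ.upper
  obtain ⟨Q1, hQ1⟩ := hψ.upper
  refine ⟨fun i => ?_, fun i => ?_, ⟨P, fun i hi => ?_⟩, ⟨max Q Q1, fun i hi => ?_⟩⟩
  · have := hφ.up i
    have := hψ.up i
    omega
  · have := hφ.down i
    have := hψ.down i
    omega
  · have := hP i hi
    omega
  · have := hQ i (by omega)
    have := hQ1 i (by omega)
    omega

/-- The interpolations `min ψ (max φ k)` sweep from `φ` to `ψ` as `k` runs from `p` to `q`, up to
values outside `]p, q[`, where the net `a` is at the base point. Raising `k` by one gives linked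
nets. -/
theorem IsReparam.cls_eq_of_le {X : PCSpace.{u}} {n : ℕ} {a b c : (OmegaIter n X).carrier} {p q : ℤ}
    (h : IsSupport a p q) {φ ψ : ℤ → ℤ} (hφ : IsReparam p q φ) (hψ : IsReparam p q ψ)
    (hle : ∀ i, φ i ≤ ψ i) (hb : ∀ i, net n b i = net n a (fun r => φ (i r)))
    (hc : ∀ i, net n c i = net n a (fun r => ψ (i r))) : piGroup.cls b = piGroup.cls c := by
  choose d hd using fun k => (hφ.interpolate (k := k) hψ).exists_net h
  have step : ∀ k, piGroup.cls (d k) = piGroup.cls (d (k + 1)) := by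
    intro k
    refine cls_eq_of_net fun i => ?_
    let χ : ℤ → ℤ → ℤ := fun k i => min (ψ i) (max (φ i) k)
    -- If the value at one of two neighbours changes, it passes from `k` to `k + 1`; there `φ ≤ k`
    -- and `k + 1 ≤ ψ`, so at the other neighbour `φ ≤ k + 1` and `k ≤ ψ`, and all four values lie
    -- in `{k, k + 1}`. Otherwise the jump bounds suffice.
    refine (net_isMap a fun r => min (min (χ k (i r)) (χ k (i r + 1)))
      (min (χ (k + 1) (i r)) (χ (k + 1) (i r + 1)))).mono ?_
    rintro _ (⟨m, hm, rfl⟩ | ⟨m, hm, rfl⟩)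
    all_goals
      rw [hd]
      refine ⟨_, ⟨fun r => ?_, fun r => ?_⟩, rfl⟩
      all_goals
        have h1 : i r ≤ m r := hm.1 r
        have h2 : m r ≤ i r + 1 := hm.2 r
        have h3 := hφ.up (i r)
        have h4 := hφ.down (i r)
        have h5 := hψ.up (i r)
        have h6 := hψ.down (i r)
        have h7 := hle (i r)
        have h8 := hle (i r + 1)
        have h5 : m r = i r ∨ m r = i r + 1 := by omega
        rcases h5 with h5 | h5 <;> simp only [h5, χ] <;> omega
  have all : ∀ k : ℕ, piGroup.cls (d p) = piGroup.cls (d (p + k)) := fun k => by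
    induction k with
    | zero => simp
    | succ k ih =>
      rw [ih, step]
      congr 2
      push_cast
      ring
  -- Reparametrisations may differ where both take values outside `]p, q[`: one such coordinate puts
  -- both nets at the base point.
  have eq_of : ∀ (e : (OmegaIter n X).carrier) (k : ℤ) (θ : ℤ → ℤ),
      (∀ i, net n e i = net n a (fun r => θ (i r))) →
      (∀ i, θ i = min (ψ i) (max (φ i) k) ∨
        ((θ i ≤ p ∨ q ≤ θ i) ∧ (min (ψ i) (max (φ i) k) ≤ p ∨
          q ≤ min (ψ i) (max (φ i) k)))) → e = d k := by
    intro e k θ he hθ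
    refine net_injective fun i => ?_
    rw [he, hd]
    by_cases hi : ∀ r, θ (i r) = min (ψ (i r)) (max (φ (i r)) k)
    · exact congrArg _ (funext hi)
    · push Not at hi
      obtain ⟨r, hr⟩ := hi
      have := (hθ (i r)).resolve_left hr
      rw [h.2 _ ⟨r, this.1⟩, h.2 _ ⟨r, this.2⟩]
  -- For `k = p` the interpolation differs from `φ` only where both are at most `p`; for `k = q` it
  -- differs from `ψ` only where both are at least `q`.
  have hpq := h.1
  rw [eq_of b p φ hb fun i => by have := hle i; omega,
    eq_of c (p + (q - p).toNat) ψ hc fun i => by have := hle i; omega]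
  exact all _

/-- The class of a net is invariant under reparametrisation. -/
theorem IsReparam.cls_eq {X : PCSpace.{u}} {n : ℕ} {a b c : (OmegaIter n X).carrier} {p q : ℤ}
    (h : IsSupport a p q) {φ ψ : ℤ → ℤ} (hφ : IsReparam p q φ) (hψ : IsReparam p q ψ)
    (hb : ∀ i, net n b i = net n a (fun r => φ (i r)))
    (hc : ∀ i, net n c i = net n a (fun r => ψ (i r))) : piGroup.cls b = piGroup.cls c := by
  obtain ⟨d, hd⟩ := (hφ.sup hψ).exists_net h
  rw [IsReparam.cls_eq_of_le h hφ (hφ.sup hψ) (fun i => le_max_left _ _) hb hd,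
    ← IsReparam.cls_eq_of_le h hψ (hφ.sup hψ) (fun i => le_max_right _ _) hc hd]

end PCSpace

/-! ### Homotopies of multi-affine extensions and the comparison mapping -/

namespace CSpace.Realization

theorem eq_vertex_of_support_subset {X : CSpace.{u}} {l : Realization X} {x : X}
    (h : l.coords.support ⊆ {x}) : l = vertex x := by
  have h1 : l.coords = Finsupp.single x (l.coords x) := (Finsupp.support_subset_singleton).1 h
  have h2 := l.sum_eq
  rw [h1, Finsupp.sum_single_index rfl] at h2
  refine ext fun y => ?_
  change l.coords y = Finsupp.single x 1 y
  rw [h1, h2]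

end CSpace.Realization

namespace PCSpace

open CSpace.Realization

/-- The support of the multi-affine extension on an elementary cube. -/
theorem support_affExt_subset {X : PCSpace.{u}} {n : ℕ} (a : (OmegaIter n X).carrier)
    {t : Fin n → ℝ} {i : Fin n → ℤ} (hi : ∀ r, i r ≤ t r ∧ t r ≤ i r + 1) :
    ((affExt a t).coords.support : Set X.carrier) ⊆ net n a '' Set.Icc i (fun r => i r + 1) := by
  intro x hx
  by_contra h
  exact (Finsupp.mem_support_iff.1 hx) (affCoords_apply_of_notMem _ hi h)

theorem affExt_eq_basePt {X : PCSpace.{u}} {n : ℕ} {a : (OmegaIter n X).carrier}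
    {t : Fin n → ℝ} {i : Fin n → ℤ} (hi : ∀ r, i r ≤ t r ∧ t r ≤ i r + 1)
    (h : ∀ k ∈ Set.Icc i (fun r => i r + 1), net n a k = X.pt) : affExt a t = X.basePt := by
  refine eq_vertex_of_support_subset fun x hx => ?_
  obtain ⟨k, hk, rfl⟩ := support_affExt_subset a hi hx
  simpa using h k hk

/-- The bounds vary with the coordinate because a concatenated net naturally fills a box which is
longer in one direction. -/
theorem affExt_of_outside {X : PCSpace.{u}} {n : ℕ} {a : (OmegaIter n X).carrier}
    {P Q : Fin n → ℤ} (h : ∀ i, (∃ r, i r ≤ P r ∨ Q r ≤ i r) → net n a i = X.pt)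
    {t : Fin n → ℝ} {r : Fin n} (ht : t r ≤ P r ∨ Q r ≤ t r) : affExt a t = X.basePt := by
  rcases ht with ht | ht
  -- The ceiling selects the cube on the lower side of an integral coordinate: when `t r = P r`, the
  -- cube given by the floor would have vertices with coordinate `P r + 1`.
  · refine affExt_eq_basePt (i := fun r => ⌈t r⌉ - 1) (fun s => ?_) fun k hk => h k ⟨r, Or.inl ?_⟩
    · have := Int.le_ceil (t s)
      have := Int.ceil_lt_add_one (t s)
      push_cast
      constructor <;> linarith
    · have h1 : k r ≤ ⌈t r⌉ - 1 + 1 := hk.2 r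
      have h2 : ⌈t r⌉ ≤ P r := Int.ceil_le.2 ht
      omega
  · refine affExt_eq_basePt (floor_bounds t) fun k hk => h k ⟨r, Or.inr ?_⟩
    exact (Int.le_floor.2 ht).trans (hk.1 r)

/-- Homotopic reparametrisations of the multi-affine extension of a net. -/
theorem homotopic_of_affExt_comp {X : PCSpace.{u}} {n : ℕ} {a : (OmegaIter n X).carrier}
    {P Q : Fin n → ℤ} (h : ∀ i, (∃ r, i r ≤ P r ∨ Q r ≤ i r) → net n a i = X.pt)
    {φ ψ : (Fin n → unitInterval) → Fin n → ℝ} (hφ : Continuous φ) (hψ : Continuous ψ)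
    {f g : Ω^ (Fin n) X.geom X.basePt} (hf : ∀ t, f t = affExt a (φ t))
    (hg : ∀ t, g t = affExt a (ψ t))
    (h0 : ∀ t r, t r = 0 → φ t r ≤ P r ∧ ψ t r ≤ P r)
    (h1 : ∀ t r, t r = 1 → Q r ≤ φ t r ∧ Q r ≤ ψ t r) : GenLoop.Homotopic f g := by
  refine ⟨⟨⟨⟨fun p => affExt a fun r => (1 - (p.1 : ℝ)) * φ p.2 r + p.1 * ψ p.2 r, ?_⟩,
    fun t => ?_, fun t => ?_⟩, fun s t ht => ?_⟩⟩
  · refine (affExt a).continuous.comp (continuous_pi fun r => ?_)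
    have h1 := ((continuous_apply r).comp hφ).comp (continuous_snd (X := unitInterval))
    have h2 := ((continuous_apply r).comp hψ).comp (continuous_snd (X := unitInterval))
    have h3 : Continuous fun p : unitInterval × (Fin n → unitInterval) => (p.1 : ℝ) :=
      continuous_subtype_val.comp continuous_fst
    exact ((continuous_const.sub h3).mul h1).add (h3.mul h2)
  · refine Eq.trans ?_ (hf t).symm
    simp
  · refine Eq.trans ?_ (hg t).symm
    simp
  · refine Eq.trans ?_ (GenLoop.boundary f t ht).symm
    obtain ⟨r, hr⟩ := ht
    -- On a face of the cube both parameters lie in one half-space where the extension is constant,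
    -- and this half-space is convex.
    refine affExt_of_outside h (r := r) ?_
    have hs0 : 0 ≤ (s : ℝ) := s.2.1
    have hs1 : (s : ℝ) ≤ 1 := s.2.2
    rcases hr with hr | hr
    · left
      obtain ⟨k1, k2⟩ := h0 t r hr
      dsimp only
      nlinarith
    · right
      obtain ⟨k1, k2⟩ := h1 t r hr
      dsimp only
      nlinarith

theorem affLoop_apply {X : PCSpace.{u}} {n : ℕ} (a : (OmegaIter n X).carrier) (p q : ℤ)
    (h : IsSupport a p q) (t : Fin n → unitInterval) :
    affLoop a p q h t = affExt a fun r => (p : ℝ) + (q - p) * (t r : ℝ) := rfl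

theorem IsSupport.mono {X : PCSpace.{u}} {n : ℕ} {a : (OmegaIter n X).carrier} {p q p1 q1 : ℤ}
    (h : IsSupport a p q) (hp : p1 ≤ p) (hq : q ≤ q1) : IsSupport a p1 q1 := by
  have := h.1
  refine ⟨by omega, fun i ⟨r, hr⟩ => h.2 i ⟨r, by omega⟩⟩

/-- For nested supports the two affine parametrisations are joined linearly; in general both
supports are compared with one containing them. -/
theorem affLoop_homotopic_of_isSupport {X : PCSpace.{u}} {n : ℕ} {a : (OmegaIter n X).carrier}
    {p q p1 q1 : ℤ} (h : IsSupport a p q) (h1 : IsSupport a p1 q1) :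
    GenLoop.Homotopic (affLoop a p q h) (affLoop a p1 q1 h1) := by
  have key : ∀ {p q p1 q1 : ℤ} (h : IsSupport a p q) (h1 : IsSupport a p1 q1), p1 ≤ p → q ≤ q1 →
      GenLoop.Homotopic (affLoop a p q h) (affLoop a p1 q1 h1) := by
    intro p q p1 q1 h h1 hp hq
    refine homotopic_of_affExt_comp (P := fun _ => p) (Q := fun _ => q) h.2
      (φ := fun t r => (p : ℝ) + (q - p) * (t r : ℝ))
      (ψ := fun t r => (p1 : ℝ) + (q1 - p1) * (t r : ℝ)) (by fun_prop) (by fun_prop)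
      (fun t => rfl) (fun t => rfl) (fun t r ht => ?_) fun t r ht => ?_
    all_goals
      have : (p1 : ℝ) ≤ p := by exact_mod_cast hp
      have : (q : ℝ) ≤ q1 := by exact_mod_cast hq
      rw [ht]
      simp
      try assumption
  exact (key h (h.mono (min_le_left p p1) (le_max_left q q1)) (min_le_left _ _)
    (le_max_left _ _)).trans (key h1 _ (min_le_right _ _) (le_max_right _ _)).symm

/-- Both nets send the elementary cube containing a point into one linked part, which bears both
values of the extensions. -/
theorem affLoop_homotopic_of_linked {X : PCSpace.{u}} {n : ℕ} {a b : (OmegaIter n X).carrier}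
    (hab : (OmegaIter n X).Linked {a, b}) {p q : ℤ} (ha : IsSupport a p q)
    (hb : IsSupport b p q) : GenLoop.Homotopic (affLoop a p q ha) (affLoop b p q hb) := by
  refine homotopicRel_of_linked _ _ (fun t => ?_) _ fun t ht =>
    ((affLoop a p q ha).2 t ht).trans ((affLoop b p q hb).2 t ht).symm
  have hi := floor_bounds fun r => (p : ℝ) + (q - p) * (t r : ℝ)
  refine (net_linked n _ hab fun r => ⌊(p : ℝ) + (q - p) * (t r : ℝ)⌋).mono ?_
  rw [Set.biUnion_pair]
  exact Set.union_subset_union (support_affExt_subset a hi) (support_affExt_subset b hi)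

/-- The homotopy class of the multi-affine extension of a net. -/
def affClass {X : PCSpace.{u}} {n : ℕ} (a : (OmegaIter n X).carrier) : π_ n X.geom X.basePt :=
  ⟦affLoop a _ _ (exists_isSupport n a).choose_spec.choose_spec.2⟧

theorem affClass_eq {X : PCSpace.{u}} {n : ℕ} {a : (OmegaIter n X).carrier} {p q : ℤ}
    (h : IsSupport a p q) : affClass a = ⟦affLoop a p q h⟧ :=
  Quotient.sound (affLoop_homotopic_of_isSupport _ h)

theorem exists_common_isSupport {X : PCSpace.{u}} {n : ℕ} (a b : (OmegaIter n X).carrier) :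
    ∃ m : ℤ, 0 < m ∧ IsSupport a (-m) m ∧ IsSupport b (-m) m := by
  obtain ⟨p, q, -, h⟩ := exists_isSupport n a
  obtain ⟨p1, q1, -, h1⟩ := exists_isSupport n b
  exact ⟨max (max 1 (max (-p) (-p1))) (max q q1), by omega, h.mono (by omega) (by omega),
    h1.mono (by omega) (by omega)⟩

/-- The comparison mapping from the combinatorial homotopy groups to those of the realisation. -/
def comparison (n : ℕ) (X : PCSpace.{u}) : piGroup n X → π_ n X.geom X.basePt :=
  Quot.lift affClass fun a b hab => by
    obtain ⟨m, -, ha, hb⟩ := exists_common_isSupport a b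
    rw [affClass_eq ha, affClass_eq hb]
    exact Quotient.sound (affLoop_homotopic_of_linked hab ha hb)

theorem comparison_cls {X : PCSpace.{u}} {n : ℕ} {a : (OmegaIter n X).carrier} {p q : ℤ}
    (h : IsSupport a p q) : comparison n X (piGroup.cls a) = ⟦affLoop a p q h⟧ := affClass_eq h

theorem comparison_cls_pt (n : ℕ) (X : PCSpace.{u}) :
    comparison n X (piGroup.cls (OmegaIter n X).pt) = ⟦GenLoop.const⟧ := by
  have h : IsSupport (OmegaIter n X).pt 0 0 := ⟨le_rfl, fun i _ => net_pt n i⟩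
  rw [comparison_cls h]
  congr 1
  refine GenLoop.ext _ _ fun t => ?_
  exact affExt_eq_basePt (floor_bounds _) fun k _ => net_pt n k

/-! ### Naturality -/

theorem net_map {X Y : PCSpace.{u}} (f : PMap X Y) : ∀ (n : ℕ) (a : (OmegaIter n X).carrier)
    (i : Fin n → ℤ), net n ((OmegaIter.map f n).toFun a) i = f.toFun (net n a i)
  | 0, _, _ => rfl
  | n + 1, a, i => net_map f n (Omega.val a (i 0)) (Fin.tail i)

theorem affExt_map {X Y : PCSpace.{u}} (f : PMap X Y) {n : ℕ} (a : (OmegaIter n X).carrier)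
    (t : Fin n → ℝ) : affExt ((OmegaIter.map f n).toFun a) t = geomMap f (affExt a t) := by
  refine CSpace.Realization.ext fun y => ?_
  change affCoords (net n _) t y = Finsupp.mapDomain f.toFun (affCoords (net n a) t) y
  rw [affCoords, affCoords, Finsupp.mapDomain_finsetSum]
  simp only [Finsupp.mapDomain_single, net_map]

theorem comparison_map {X Y : PCSpace.{u}} (n : ℕ) (f : PMap X Y) (x : piGroup n X) :
    comparison n Y (piGroup.map n f x) =
      topPiMap n (geomMap f) (geomMap_basePt f) (comparison n X x) := by
  obtain ⟨a, rfl⟩ := Quot.exists_rep x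
  obtain ⟨p, q, -, h⟩ := exists_isSupport n a
  have h1 : IsSupport ((OmegaIter.map f n).toFun a) p q :=
    ⟨h.1, fun i hi => by rw [net_map, h.2 i hi, f.map_pt]⟩
  change comparison n Y (piGroup.cls _) = topPiMap n _ _ (comparison n X (piGroup.cls a))
  rw [comparison_cls h, comparison_cls h1]
  exact congrArg (fun l => (⟦l⟧ : π_ n Y.geom Y.basePt))
    (GenLoop.ext _ _ fun t => affExt_map f a _)

/-! ### Products -/

/-- The weights depend only on differences `t r - k r`, hence are invariant under integral
translation. Agreement is asked on a single cube because a concatenation is a translate of each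
factor on one half only. -/
theorem affExt_eq_of_shift {X : PCSpace.{u}} {n : ℕ} {a c : (OmegaIter n X).carrier}
    {t : Fin n → ℝ} {i : Fin n → ℤ} (hi : ∀ r, i r ≤ t r ∧ t r ≤ i r + 1) (v : Fin n → ℤ)
    (h : ∀ k ∈ Set.Icc i (fun r => i r + 1), net n c k = net n a (k + v)) :
    affExt c t = affExt a (fun r => t r + v r) := by
  refine CSpace.Realization.ext fun y => ?_
  change affCoords (net n c) t y = affCoords (net n a) _ y
  rw [affCoords_eq _ hi, affCoords_eq (i := i + v) _ fun r => ?_]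
  · refine congrArg (fun l : X.carrier →₀ ℝ => l y) ?_
    refine Finset.sum_nbij' (· + v) (· - v) (fun k hk => ?_) (fun k hk => ?_)
      (fun k _ => add_sub_cancel_right k v) (fun k _ => sub_add_cancel k v) fun k hk => ?_
    · rw [Finset.mem_Icc] at hk ⊢
      refine ⟨fun r => ?_, fun r => ?_⟩
      · have : i r ≤ k r := hk.1 r
        simpa using this
      · have : k r ≤ i r + 1 := hk.2 r
        simp only [Pi.add_apply]
        omega
    · rw [Finset.mem_Icc] at hk ⊢
      refine ⟨fun r => ?_, fun r => ?_⟩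
      · have : i r + v r ≤ k r := hk.1 r
        simp only [Pi.sub_apply]
        omega
      · have : k r ≤ i r + v r + 1 := hk.2 r
        simp only [Pi.sub_apply]
        omega
    · rw [h k (by simpa using hk)]
      congr 1
      refine Finset.prod_congr rfl fun r _ => ?_
      simp
  · simp only [Pi.add_apply, Int.cast_add]
    constructor <;> linarith [(hi r).1, (hi r).2]

theorem IsSupport.val_eq_pt {X : PCSpace.{u}} {n : ℕ} {a : (OmegaIter (n + 1) X).carrier} {p q : ℤ}
    (h : IsSupport a p q) {j : ℤ} (hj : j ≤ p ∨ q ≤ j) : Omega.val a j = (OmegaIter n X).pt :=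
  net_injective fun i => (h.2 (Fin.cons j i) ⟨0, hj⟩).trans (net_pt n i).symm

/-- The net `c` vanishes outside the box `[-2m, 2m] × [-m, m]^n`, and rescaling this box to the unit
cube gives exactly the concatenation of the two loops. It remains to deform the cubical support
`[-2m, 2m]^(n+1)` to the box. -/
theorem comparison_cls_concat {X : PCSpace.{u}} {n : ℕ} {a b c : (OmegaIter (n + 1) X).carrier} {m : ℤ}
    (hm : 0 < m) (ha : IsSupport a (-m) m) (hb : IsSupport b (-m) m)
    (hc1 : ∀ i ≤ 0, Omega.val c i = Omega.val a (i + m))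
    (hc2 : ∀ i, 0 ≤ i → Omega.val c i = Omega.val b (i - m)) :
    comparison (n + 1) X (piGroup.cls c) =
      ⟦GenLoop.transAt 0 (affLoop a _ _ ha) (affLoop b _ _ hb)⟧ := by
  -- `P` and `Q` are the corners of the box, and `e` is the translation which carries its first half
  -- to the support of `a`; `-e` does the same for the second half and `b`.
  let P : Fin (n + 1) → ℤ := Fin.cons (-(2 * m)) fun _ => -m
  let Q : Fin (n + 1) → ℤ := Fin.cons (2 * m) fun _ => m
  let e : Fin (n + 1) → ℤ := Fin.cons m 0
  have k1 : ∀ i : Fin (n + 1) → ℤ, i 0 ≤ 0 → net (n + 1) c i = net (n + 1) a (i + e) := by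
    intro i hi
    rw [net_succ, hc1 _ hi, net_succ]
    congr 1
    funext r
    simp [Fin.tail, e]
  have k2 : ∀ i : Fin (n + 1) → ℤ, 0 ≤ i 0 → net (n + 1) c i = net (n + 1) b (i + -e) := by
    intro i hi
    rw [net_succ, hc2 _ hi, net_succ]
    congr 1
    funext r
    simp [Fin.tail, e]
  have hPQ : ∀ i, (∃ r, i r ≤ P r ∨ Q r ≤ i r) → net (n + 1) c i = X.pt := by
    rintro i ⟨r, hr⟩
    rcases le_total (i 0) 0 with hi | hi
    · rw [k1 i hi]
      refine ha.2 _ ⟨r, ?_⟩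
      induction r using Fin.cases with
      | zero => simp [P, Q, e] at hr ⊢; omega
      | succ r => simpa [P, Q, e] using hr
    · rw [k2 i hi]
      refine hb.2 _ ⟨r, ?_⟩
      induction r using Fin.cases with
      | zero => simp [P, Q, e] at hr ⊢; omega
      | succ r => simpa [P, Q, e] using hr
  have hc : IsSupport c (-(2 * m)) (2 * m) := by
    refine ⟨by omega, fun i ⟨r, hr⟩ => hPQ i ⟨r, ?_⟩⟩
    induction r using Fin.cases with
    | zero => simpa [P, Q] using hr
    | succ r => simp [P, Q]; omega
  rw [comparison_cls hc]
  refine Quotient.sound (homotopic_of_affExt_comp hPQ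
    (φ := fun t r => ((-(2 * m) : ℤ) : ℝ) + (((2 * m : ℤ) : ℝ) - ((-(2 * m) : ℤ) : ℝ)) * (t r : ℝ))
    (ψ := fun t r => (P r : ℝ) + (Q r - P r) * (t r : ℝ)) (by fun_prop) (by fun_prop)
    (fun t => rfl) (fun t => ?_) (fun t r ht => ?_) fun t r ht => ?_)
  · have hm' : (0 : ℝ) < m := by exact_mod_cast hm
    rw [GenLoop.transAt, GenLoop.coe_copy]
    split_ifs with h2
    -- The first half includes `t 0 = 1/2`, that is the pasting hyperplane, so the cube is taken by
    -- ceilings to keep it on the side of `a`; floors serve the second half.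
    · rw [affLoop_apply, affExt_eq_of_shift (a := a)
        (i := fun r => ⌈(P r : ℝ) + (Q r - P r) * (t r : ℝ)⌉ - 1) (fun r => ?_) e fun k hk => k1 k ?_]
      · congr 1
        funext r
        induction r using Fin.cases with
        | zero =>
          have : (0 : ℝ) ≤ t 0 := (t 0).2.1
          simp [P, Q, e, Set.projIcc_of_mem zero_le_one
            (show 2 * (t 0 : ℝ) ∈ Set.Icc 0 1 from ⟨by linarith, by linarith⟩)]
          ring
        | succ r => simp [P, Q, e]
      · have := Int.le_ceil ((P r : ℝ) + (Q r - P r) * (t r : ℝ))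
        have := Int.ceil_lt_add_one ((P r : ℝ) + (Q r - P r) * (t r : ℝ))
        push_cast
        constructor <;> linarith
      · have h3 : k 0 ≤ ⌈(P 0 : ℝ) + (Q 0 - P 0) * (t 0 : ℝ)⌉ - 1 + 1 := hk.2 0
        have h4 : ⌈(P 0 : ℝ) + (Q 0 - P 0) * (t 0 : ℝ)⌉ ≤ 0 := by
          refine Int.ceil_le.2 ?_
          simp [P, Q]
          nlinarith
        omega
    · rw [affLoop_apply, affExt_eq_of_shift (a := b) (floor_bounds _) (-e) fun k hk => k2 k ?_]
      · congr 1
        funext r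
        induction r using Fin.cases with
        | zero =>
          have : (t 0 : ℝ) ≤ 1 := (t 0).2.2
          simp [P, Q, e, Set.projIcc_of_mem zero_le_one
            (show 2 * (t 0 : ℝ) - 1 ∈ Set.Icc 0 1 from ⟨by linarith, by linarith⟩)]
          ring
        | succ r => simp [P, Q, e]
      · refine le_trans (Int.le_floor.2 ?_) (hk.1 0)
        simp [P, Q]
        nlinarith
  all_goals
    rw [ht]
    induction r using Fin.cases with
    | zero => simp [P, Q]
    | succ r =>
      have hm' : (0 : ℝ) < m := by exact_mod_cast hm
      simp [P, Q]
      linarith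

/-- The comparison mapping takes products to concatenations. -/
theorem comparison_mul {X : PCSpace.{u}} {n : ℕ} (x y : piGroup (n + 1) X) (i : Fin (n + 1))
    (f g : Ω^ (Fin (n + 1)) X.geom X.basePt) (hf : comparison (n + 1) X x = ⟦f⟧)
    (hg : comparison (n + 1) X y = ⟦g⟧) :
    comparison (n + 1) X (x * y) = ⟦GenLoop.transAt i f g⟧ := by
  obtain ⟨a, rfl⟩ := Quot.exists_rep x
  obtain ⟨b, rfl⟩ := Quot.exists_rep y
  obtain ⟨m, hm, ha, hb⟩ := exists_common_isSupport a b
  have hc := Omega.isConcat_concat (X := OmegaIter n X) a b m (-m)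
    (fun i hi => ha.val_eq_pt (Or.inr hi)) (fun i hi => hb.val_eq_pt (Or.inl hi))
  have e : (piGroup.cls a * piGroup.cls b : piGroup (n + 1) X) = piGroup.cls (X := X) (n := n + 1)
      (Omega.concat (X := OmegaIter n X) a b m (-m) (fun i hi => ha.val_eq_pt (Or.inr hi))
        (fun i hi => hb.val_eq_pt (Or.inl hi))) := Omega.mul_cls hc
  change comparison (n + 1) X (piGroup.cls a * piGroup.cls b) = _
  rw [e]
  refine (comparison_cls_concat hm ha hb (fun i hi => ?_) fun i hi => ?_).trans ?_
  · refine (Omega.val_mk (X := OmegaIter n X) _ _ _ i).trans ?_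
    rw [if_pos (by omega), sub_neg_eq_add]
  · refine (Omega.val_mk (X := OmegaIter n X) _ _ _ i).trans ?_
    -- Only the pasting instant `0` falls in the first case, and there both loops are at the base
    -- point.
    split_ifs with h
    · rw [ha.val_eq_pt (Or.inr (by omega)), hb.val_eq_pt (Or.inl (by omega))]
    · rfl
  -- Nets are concatenated along the coordinate `0`; topologically the direction is irrelevant. In
  -- `HomotopyGroup.mul_spec` the loop run first is the right factor, whence `b` before `a`.
  · rw [HomotopyGroup.transAt_indep (i := 0) i, ← HomotopyGroup.mul_spec, ← HomotopyGroup.mul_spec,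
      ← hf, ← hg]
    exact congrArg₂ (fun x y : π_ (n + 1) X.geom X.basePt => x * y) (comparison_cls hb).symm
      (comparison_cls ha).symm

end PCSpace

namespace PCSpace

open CSpace.Realization

/-! ### Simplicial approximation on integral grids -/

/-- The point of the unit interval with coordinate `i / N`, truncated. -/
def gridPt (N i : ℤ) : unitInterval := Set.projIcc 0 1 zero_le_one ((i : ℝ) / N)

theorem gridPt_of_nonpos {N i : ℤ} (hN : 0 < N) (hi : i ≤ 0) : gridPt N i = 0 :=
  Set.projIcc_of_le_left _ (div_nonpos_of_nonpos_of_nonneg (by exact_mod_cast hi)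
    (by exact_mod_cast hN.le))

theorem gridPt_of_le {N i : ℤ} (hN : 0 < N) (hi : N ≤ i) : gridPt N i = 1 :=
  Set.projIcc_of_right_le _ ((one_le_div (by exact_mod_cast hN)).2 (by exact_mod_cast hi))

theorem coe_gridPt {N i : ℤ} (hN : 0 < N) (h0 : 0 ≤ i) (h1 : i ≤ N) :
    (gridPt N i : ℝ) = (i : ℝ) / N := by
  have hN' : (0 : ℝ) < N := by exact_mod_cast hN
  have h0' : (0 : ℝ) ≤ i := by exact_mod_cast h0
  have h1' : (i : ℝ) ≤ N := by exact_mod_cast h1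
  rw [gridPt, Set.projIcc_of_mem zero_le_one ⟨div_nonneg h0' hN'.le, (div_le_one hN').2 h1'⟩]

theorem dist_projIcc_gridPt_lt {N : ℤ} {δ : ℝ} (hN : 0 < N) (hδ : 1 / (N : ℝ) < δ) {s : ℝ} {k : ℤ}
    (h : |s - k| ≤ 1) : dist (Set.projIcc 0 1 zero_le_one (s / N) : unitInterval) (gridPt N k) < δ := by
  have hN' : (0 : ℝ) < N := by exact_mod_cast hN
  refine lt_of_le_of_lt ?_ hδ
  have h1 := (LipschitzWith.projIcc (zero_le_one (α := ℝ))).dist_le_mul (s / N) (k / N)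
  refine h1.trans ?_
  rw [NNReal.coe_one, one_mul, Real.dist_eq, ← sub_div, abs_div, abs_of_pos hN']
  gcongr

theorem dist_gridPt_lt {N : ℤ} {δ : ℝ} (hN : 0 < N) (hδ : 1 / (N : ℝ) < δ) {i k : ℤ}
    (h : i ≤ k) (h' : k ≤ i + 1) : dist (gridPt N i) (gridPt N k) < δ := by
  refine dist_projIcc_gridPt_lt hN hδ ?_
  have h1 : (i : ℝ) ≤ k := by exact_mod_cast h
  have h2 : (k : ℝ) ≤ i + 1 := by exact_mod_cast h'
  rw [abs_le]
  constructor <;> linarith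

theorem dist_gridPt_of_mem {N : ℤ} {δ : ℝ} (hN : 0 < N) (hδ : 1 / (N : ℝ) < δ)
    {t : unitInterval} {k : ℤ} (h : ⌊(N : ℝ) * t⌋ ≤ k) (h' : k ≤ ⌊(N : ℝ) * t⌋ + 1) :
    dist t (gridPt N k) < δ := by
  have hN' : (N : ℝ) ≠ 0 := by exact_mod_cast hN.ne'
  have e : t = Set.projIcc 0 1 zero_le_one ((N : ℝ) * t / N) := by
    rw [mul_div_cancel_left₀ _ hN', Set.projIcc_val]
  rw [e]
  refine dist_projIcc_gridPt_lt hN hδ ?_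
  have h1 : (⌊(N : ℝ) * t⌋ : ℝ) ≤ k := by exact_mod_cast h
  have h2 : (k : ℝ) ≤ ⌊(N : ℝ) * t⌋ + 1 := by exact_mod_cast h'
  have h3 := Int.floor_le ((N : ℝ) * t)
  have h4 := Int.lt_floor_add_one ((N : ℝ) * t)
  rw [abs_le]
  constructor <;> linarith

/-- Open stars with a common point have linked centres. All the linkedness conditions on
approximations are obtained by exhibiting such a point. -/
theorem linked_of_coords_pos {X : CSpace.{u}} (l : CSpace.Realization X) {s : Set X}
    (h : ∀ x ∈ s, 0 < l.coords x) : X.Linked s :=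
  l.linked.mono fun x hx => Finsupp.mem_support_iff.2 (h x hx).ne'

theorem exists_int_one_div_lt {δ : ℝ} (hδ : 0 < δ) : ∃ N : ℤ, 0 < N ∧ 1 / (N : ℝ) < δ := by
  obtain ⟨n, hn⟩ := exists_nat_one_div_lt hδ
  exact ⟨n + 1, by omega, by push_cast; exact hn⟩

theorem boundary_gridPt {n : ℕ} {N : ℤ} (hN : 0 < N) {i : Fin n → ℤ} (h : ∃ r, i r ≤ 0 ∨ N ≤ i r) :
    (fun r => gridPt N (i r)) ∈ Cube.boundary (Fin n) := by
  obtain ⟨r, hr⟩ := h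
  exact ⟨r, hr.imp (gridPt_of_nonpos hN) (gridPt_of_le hN)⟩

/-- Each grid node is sent to a vertex whose open star contains the image of its `δ`-ball. The nodes
of an elementary cube are all `δ`-close to its lower corner, so their stars meet and the choice is a
net. -/
theorem comparison_surjective (n : ℕ) (X : PCSpace.{u}) :
    Function.Surjective (comparison n X) := by
  intro y
  obtain ⟨f, rfl⟩ := Quotient.exists_rep y
  obtain ⟨δ, hδ, h⟩ := exists_star_of_dist_lt f.1
  choose v hv using h
  obtain ⟨N, hN, hNδ⟩ := exists_int_one_div_lt hδ
  let τ : (Fin n → ℤ) → Fin n → unitInterval := fun i r => gridPt N (i r)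
  -- At truncated or boundary nodes the loop is at the vertex `X.pt`, whose only open star is its
  -- own.
  have hpt : ∀ i, (∃ r, i r ≤ 0 ∨ N ≤ i r) → v (τ i) = X.pt := by
    intro i hi
    have := hv (τ i) (τ i) (by simpa using hδ)
    rw [f.2 _ (boundary_gridPt hN hi)] at this
    exact eq_of_vertex_coords_pos this
  obtain ⟨a, ha⟩ := exists_net (X := X) (fun i => v (τ i)) (fun i => by
    refine linked_of_coords_pos (f (τ i)) ?_
    rintro _ ⟨k, hk, rfl⟩
    exact hv (τ k) (τ i) ((dist_pi_lt_iff hδ).2 fun r =>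
      dist_gridPt_lt hN hNδ (hk.1 r) (hk.2 r))) 0 N hpt
  have hs : IsSupport a 0 N := ⟨hN.le, fun i hi => (ha i).trans (hpt i hi)⟩
  refine ⟨piGroup.cls a, ?_⟩
  rw [comparison_cls hs]
  -- The vertices bearing the extension at `t` come from nodes `δ`-close to `t`, so they belong to
  -- the support of `f t`: the two points lie in a common simplex.
  refine Quotient.sound (homotopicRel_of_linked _ _ (fun t => ?_) _ fun t ht =>
    ((affLoop a 0 N hs).2 t ht).trans (f.2 t ht).symm)
  refine linked_of_coords_pos (f t) ?_
  rintro x (hx | hx)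
  · have hx' : x ∈ ((affExt a fun r => ((0 : ℤ) : ℝ) + (N - ((0 : ℤ) : ℝ)) * (t r : ℝ)).coords.support
        : Set X.carrier) := hx
    obtain ⟨k, hk, rfl⟩ := support_affExt_subset a (floor_bounds _) hx'
    rw [ha]
    refine hv (τ k) t ((dist_pi_lt_iff hδ).2 fun r => dist_gridPt_of_mem hN hNδ ?_ ?_)
    · simpa using hk.1 r
    · simpa using hk.2 r
  · exact lt_of_le_of_ne ((f t).nonneg x) (Finsupp.mem_support_iff.1 hx).symm

/-! ### Subdivision and injectivity -/

/-- The subdivision of the line with `M` steps for each unit interval, starting at `p`. -/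
theorem isReparam_subdivision {p q M : ℤ} (hM : 0 < M) :
    IsReparam p q fun i => p + i / M := by
  refine ⟨fun i => ?_, fun i => ?_, ⟨0, fun i hi => ?_⟩, ⟨(q - p) * M, fun i hi => ?_⟩⟩
  · have : (i + 1) / M ≤ i / M + 1 := by
      rw [← Int.add_mul_ediv_right i 1 hM.ne']
      exact Int.ediv_le_ediv hM (by omega)
    omega
  · have : i / M ≤ (i + 1) / M := Int.ediv_le_ediv hM (by omega)
    omega
  · have : i / M ≤ 0 := Int.ediv_nonpos_of_nonpos_of_neg hi hM
    omega
  · have := (Int.le_ediv_iff_mul_le hM).2 hi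
    omega

theorem isReparam_id (p q : ℤ) : IsReparam p q fun i => i :=
  ⟨fun i => le_rfl, fun i => by omega, ⟨p, fun i hi => hi⟩, ⟨q, fun i hi => hi⟩⟩

/-- An approximation of the multi-affine extension of a net on a subdivision is in the class of
the net. -/
theorem cls_eq_of_approximation {X : PCSpace.{u}} {n : ℕ} {a c : (OmegaIter n X).carrier}
    {p q M : ℤ} (ha : IsSupport a p q) (hpq : p < q) (hM : 0 < M)
    (hc : ∀ i, (∃ r, i r ≤ 0 ∨ (q - p) * M ≤ i r) → net n c i = X.pt)
    (h : ∀ i : Fin n → ℤ, ∀ k ∈ Set.Icc i (fun r => i r + 1),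
      0 < (affLoop a p q ha fun r => gridPt ((q - p) * M) (i r)).coords (net n c k)) :
    piGroup.cls c = piGroup.cls a := by
  have hφ := isReparam_subdivision (p := p) (q := q) hM
  obtain ⟨b, hb⟩ := hφ.exists_net ha
  rw [← IsReparam.cls_eq ha hφ (isReparam_id p q) hb (fun i => rfl)]
  have hM' : (0 : ℝ) < M := by exact_mod_cast hM
  have hpq' : (0 : ℝ) < q - p := by
    rw [sub_pos]
    exact_mod_cast hpq
  have hN : 0 < (q - p) * M := mul_pos (by omega) hM
  refine cls_eq_of_net fun i => ?_
  -- The inequality at `0` is strict so that the upper nodes too have coordinate at most `0`; in the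
  -- remaining case `gridPt` is not truncated.
  by_cases hi : ∃ r, i r < 0 ∨ (q - p) * M ≤ i r
  · refine (X.linked_singleton X.pt).mono ?_
    obtain ⟨r, hr⟩ := hi
    have key : ∀ k ∈ Set.Icc i (fun r => i r + 1), k r ≤ 0 ∨ (q - p) * M ≤ k r := fun k hk => by
      have h1 : i r ≤ k r := hk.1 r
      have h2 : k r ≤ i r + 1 := hk.2 r
      omega
    rintro _ (⟨k, hk, rfl⟩ | ⟨k, hk, rfl⟩)
    · exact hc k ⟨r, key k hk⟩
    · refine (hb k).trans (ha.2 _ ⟨r, (key k hk).imp (fun h1 => ?_) fun h1 => ?_⟩)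
      · have : k r / M ≤ 0 := Int.ediv_nonpos_of_nonpos_of_neg h1 hM
        omega
      · have := (Int.le_ediv_iff_mul_le hM).2 h1
        omega
  · push Not at hi
    -- One elementary cube of `a` serves both nets. It contains the point of coordinates `p + i r /
    -- M`, at which the extension is positive on the values of `c`, and also the nodes where `b`
    -- evaluates `a`.
    refine (net_isMap a fun r => p + i r / M).mono (Set.union_subset ?_ ?_)
    · rintro _ ⟨k, hk, rfl⟩
      refine support_affExt_subset a (fun r => ?_) (Finsupp.mem_support_iff.2 (h i k hk).ne')
      obtain ⟨h1, h2⟩ := hi r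
      change _ ≤ (p : ℝ) + (q - p) * (gridPt ((q - p) * M) (i r) : ℝ) ∧
        (p : ℝ) + (q - p) * (gridPt ((q - p) * M) (i r) : ℝ) ≤ _
      rw [coe_gridPt hN h1 h2.le]
      have h3 : (p : ℝ) + (q - p) * ((i r : ℝ) / (((q - p) * M : ℤ) : ℝ)) = p + (i r : ℝ) / M := by
        push_cast
        field_simp
      rw [h3]
      have h4 : ((i r / M : ℤ) : ℝ) ≤ (i r : ℝ) / M := by
        rw [le_div_iff₀ hM']
        exact_mod_cast Int.ediv_mul_le _ hM.ne'
      have h5 : (i r : ℝ) / M ≤ ((i r / M : ℤ) : ℝ) + 1 := by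
        rw [div_le_iff₀ hM']
        exact_mod_cast (Int.lt_ediv_add_one_mul_self (i r) hM).le
      push_cast
      constructor <;> linarith
    · rintro _ ⟨k, hk, rfl⟩
      rw [hb]
      refine ⟨_, ⟨fun r => ?_, fun r => ?_⟩, rfl⟩
      all_goals
        have h1 : i r ≤ k r := hk.1 r
        have h2 : k r ≤ i r + 1 := hk.2 r
        have h3 := hφ.up (i r)
        have h4 : i r / M ≤ (i r + 1) / M := Int.ediv_le_ediv hM (by omega)
        have h5 : k r = i r ∨ k r = i r + 1 := by omega
        rcases h5 with h5 | h5 <;> simp only [h5] <;> omega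

/-- Approximating the homotopy on a grid of `I × I^n` gives nets `c j`, one for each time `j`. The
stars chosen on two consecutive slices of a cube share a point, so consecutive nets are linked. -/
theorem cls_eq_of_homotopic {X : PCSpace.{u}} {n : ℕ} {a b : (OmegaIter n X).carrier} {p q : ℤ}
    (ha : IsSupport a p q) (hb : IsSupport b p q) (hpq : p < q)
    (H : GenLoop.Homotopic (affLoop a p q ha) (affLoop b p q hb)) :
    piGroup.cls a = piGroup.cls b := by
  obtain ⟨H⟩ := H
  obtain ⟨δ, hδ, h⟩ := exists_star_of_dist_lt H.toContinuousMap
  choose v hv using h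
  -- Taking `(q - p) * M` steps, rather than an arbitrary fine number, makes the grid on `[0, 1]` a
  -- subdivision of the integral points of `[p, q]`. The same number of steps is used for the time.
  obtain ⟨M, hM, hMδ⟩ := exists_int_one_div_lt hδ
  have hN : 0 < (q - p) * M := mul_pos (by omega) hM
  have hNδ : 1 / (((q - p) * M : ℤ) : ℝ) < δ := by
    refine lt_of_le_of_lt ?_ hMδ
    have hM' : (0 : ℝ) < M := by exact_mod_cast hM
    refine one_div_le_one_div_of_le hM' ?_
    have : M ≤ (q - p) * M := le_mul_of_one_le_left hM.le (by omega)
    exact_mod_cast this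
  generalize hNe : (q - p) * M = N at hN hNδ
  let τ : ℤ → (Fin n → ℤ) → unitInterval × (Fin n → unitInterval) :=
    fun j i => (gridPt N j, fun r => gridPt N (i r))
  have hpt : ∀ j i, (∃ r, i r ≤ 0 ∨ N ≤ i r) → v (τ j i) = X.pt := by
    intro j i hi
    have h1 : 0 < (H (τ j i)).coords (v (τ j i)) := hv (τ j i) (τ j i) (by simpa using hδ)
    have h2 : H (τ j i) = X.basePt := (H.eq_fst _ (boundary_gridPt hN hi)).trans
      ((affLoop a p q ha).2 _ (boundary_gridPt hN hi))
    rw [h2] at h1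
    exact eq_of_vertex_coords_pos h1
  have hpos : ∀ j m i, ∀ k ∈ Set.Icc i (fun r => i r + 1), j ≤ m → m ≤ j + 1 →
      0 < (H (τ j i)).coords (v (τ m k)) := fun j m i k hk h1 h2 =>
    hv (τ m k) (τ j i) (max_lt (dist_gridPt_lt hN hNδ h1 h2)
      ((dist_pi_lt_iff hδ).2 fun r => dist_gridPt_lt hN hNδ (hk.1 r) (hk.2 r)))
  have ex : ∀ j, ∃ c : (OmegaIter n X).carrier, ∀ i, net n c i = v (τ j i) := fun j =>
    exists_net (fun i => v (τ j i)) (fun i => by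
      refine linked_of_coords_pos (H (τ j i)) ?_
      rintro _ ⟨k, hk, rfl⟩
      exact hpos j j i k hk le_rfl (by omega)) 0 N (hpt j)
  choose c hc using ex
  have step : ∀ j, piGroup.cls (c j) = piGroup.cls (c (j + 1)) := fun j => by
    refine cls_eq_of_net fun i => linked_of_coords_pos (H (τ j i)) ?_
    rintro _ (⟨k, hk, rfl⟩ | ⟨k, hk, rfl⟩) <;> rw [hc]
    · exact hpos j j i k hk le_rfl (by omega)
    · exact hpos j (j + 1) i k hk (by omega) le_rfl
  have all : ∀ k : ℕ, piGroup.cls (c 0) = piGroup.cls (c k) := fun k => by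
    induction k with
    | zero => rfl
    | succ k ih => rw [ih, step]; norm_cast
  -- At time `0` the homotopy is the extension of `a`, so `c 0` approximates it on the subdivided
  -- grid; likewise `c N` and `b` at time `1`.
  have e0 : piGroup.cls (c 0) = piGroup.cls a := by
    subst hNe
    refine cls_eq_of_approximation ha hpq hM (fun i hi => (hc 0 i).trans (hpt 0 i hi))
      fun i k hk => ?_
    have h1 := hpos 0 0 i k hk le_rfl (by omega)
    have h2 : τ 0 i = (0, fun r => gridPt _ (i r)) := Prod.ext (gridPt_of_nonpos hN le_rfl) rfl
    rw [h2, ContinuousMap.HomotopyWith.apply_zero] at h1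
    rw [hc]
    exact h1
  have e1 : piGroup.cls (c N) = piGroup.cls b := by
    subst hNe
    refine cls_eq_of_approximation hb hpq hM (fun i hi => (hc _ i).trans (hpt _ i hi))
      fun i k hk => ?_
    have h1 := hpos ((q - p) * M) ((q - p) * M) i k hk le_rfl (by omega)
    have h2 : τ ((q - p) * M) i = (1, fun r => gridPt _ (i r)) :=
      Prod.ext (gridPt_of_le hN le_rfl) rfl
    rw [h2, ContinuousMap.HomotopyWith.apply_one] at h1
    rw [hc]
    exact h1
  rw [← e0, ← e1, all N.toNat, Int.toNat_of_nonneg hN.le]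

theorem comparison_injective (n : ℕ) (X : PCSpace.{u}) :
    Function.Injective (comparison n X) := by
  intro x y hxy
  obtain ⟨a, rfl⟩ := Quot.exists_rep x
  obtain ⟨b, rfl⟩ := Quot.exists_rep y
  obtain ⟨m, hm, ha, hb⟩ := exists_common_isSupport a b
  have h : (⟦affLoop a _ _ ha⟧ : π_ n X.geom X.basePt) = ⟦affLoop b _ _ hb⟧ :=
    (comparison_cls ha).symm.trans (hxy.trans (comparison_cls hb))
  exact cls_eq_of_homotopic ha hb (by omega) (Quotient.exact h)

end PCSpace


end

/-- The simplicial comparison: for pointed simplicial complexes `X` there is a family of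
isomorphisms `Φ n X : π_n(X) → π_n(|X|)`, natural in `X`, sending the class of a net to the class of
its multi-affine extension. It is a bijection preserving the base point for all `n`, and for
positive `n` it takes the product of `π_n(X)` (`[a] * [b]` is the class of "first `a`, then `b`") to
the concatenation of topological loops; `GenLoop.transAt i f g` runs through `f` first, then `g`. -/
theorem theorem6p6 :
    ∃ Φ : ∀ (n : ℕ) (X : PCSpace.{u}), PCSpace.piGroup n X → π_ n X.geom X.basePt,
      -- bijectivity
      (∀ (n : ℕ) (X : PCSpace.{u}), Function.Bijective (Φ n X)) ∧
      -- the class of a net is sent to the class of its multi-affine extension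
      (∀ (n : ℕ) (X : PCSpace.{u}) (a : (PCSpace.OmegaIter n X).carrier) (p q : ℤ)
        (h : PCSpace.IsSupport a p q),
        Φ n X (PCSpace.piGroup.cls a) = ⟦PCSpace.affLoop a p q h⟧) ∧
      -- base points are preserved
      (∀ (n : ℕ) (X : PCSpace.{u}),
        Φ n X (PCSpace.piGroup.cls (PCSpace.OmegaIter n X).pt) = ⟦GenLoop.const⟧) ∧
      -- products are preserved in positive degree
      (∀ (n : ℕ) (X : PCSpace.{u}) (x y : PCSpace.piGroup (n + 1) X) (i : Fin (n + 1))
        (f g : Ω^ (Fin (n + 1)) X.geom X.basePt),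
        Φ (n + 1) X x = ⟦f⟧ → Φ (n + 1) X y = ⟦g⟧ →
          Φ (n + 1) X (x * y) = ⟦GenLoop.transAt i f g⟧) ∧
      -- naturality
      (∀ (n : ℕ) (X Y : PCSpace.{u}) (f : PMap X Y) (x : PCSpace.piGroup n X),
        Φ n Y (PCSpace.piGroup.map n f x) =
          topPiMap n (PCSpace.geomMap f) (PCSpace.geomMap_basePt f) (Φ n X x)) := by
  exact ⟨PCSpace.comparison, fun n X => ⟨PCSpace.comparison_injective n X,
    PCSpace.comparison_surjective n X⟩, fun _ _ _ _ _ h => PCSpace.comparison_cls h,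
    PCSpace.comparison_cls_pt, fun _ _ => PCSpace.comparison_mul, fun n _ _ => PCSpace.comparison_map n⟩
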